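/- Let $G=(V,E)$ be a finite simple graph with a straight-line drawing $\Gamma$ in the plane (vertices are placed at points of $\mathbb R^2$, edges are drawn as closed segments). Two edges *cross* if they have no common endvertex and their segments intersect. For an edge $uv$ and a point $p\in\mathbb R^2$, let $\overline{E}_{uv}(p)$ be the set of all edges $e\in E$ that are not crossed by $uv$ in the drawing obtained from $\Gamma$ by moving $v$ to $p$, and let $\overline{\mathcal F}_{uv}=\{\overline{E}_{uv}(p) : p\in\mathbb R^2\}$. For a finite set $X$ and $\mathcal F\subseteq 2^X$, a nonempty set $S\subseteq X$ is a *relative $(\varepsilon,\delta)$-approximation* of $(X,\mathcal F)$ if for every $R\in\mathcal F$ $$\left|\frac{|S\cap R|}{|S|}-\frac{|R|}{|X|}\right|\le \delta\,\max\left\{\frac{|R|}{|X|},\varepsilon\right\}.$$ **Lemma.** For every $\eta<1$ there is a constant $C=C(\eta)>0$ such that the following holds for every such $G$ and $\Gamma$. Let $v$ be a vertex of degree $k$ and let $\varepsilon,\delta,\gamma\in(0,1]$ with $k\gamma\le 1$ and $\varepsilon\gamma\le\eta$. Let $m\le |E|$ be an integer with $$m\ \ge\ \min\left\{\,C\cdot\frac{\log\varepsilon^{-1}+\log\gamma^{-1}}{\varepsilon\delta^2},\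 |E|\right\},$$ and let $S$ be a uniformly random $m$-element subset of $E$. Then with probability at least $1-k\gamma$, the set $S$ is simultaneously, for every edge $uv\in E$ incident to $v$, a relative $(\varepsilon,\delta)$-approximation of the set system $(E,\overline{\mathcal F}_{uv})$. (For $k\ge 2$ the condition $\varepsilon\gamma\le\eta$ is automatic with $\eta=\tfrac12$, so $C$ is then an absolute constant.) -/

import Mathlib

/-- The Euclidean plane. -/
abbrev Plane : Type := EuclideanSpace ℝ (Fin 2)

/-- A straight-line drawing of a graph on `V` is given by the positions of its vertices; every edge
is drawn as the segment between the positions of its two endpoints. No general position is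
required. -/
abbrev StraightLineDrawing (V : Type*) : Type _ := V → Plane

section Drawings

variable {V : Type*}

/-- The closed segment that represents the edge `e`. -/
def edgeSegment (Γ : StraightLineDrawing V) (e : Sym2 V) : Set Plane :=
  convexHull ℝ (Γ '' {x | x ∈ e})

theorem edgeSegment_mk (Γ : StraightLineDrawing V) (a b : V) :
    edgeSegment Γ s(a, b) = segment ℝ (Γ a) (Γ b) := by
  have h : {x | x ∈ s(a, b)} = ({a, b} : Set V) := by
    ext x
    simp
  rw [edgeSegment, h, Set.image_pair, convexHull_pair]

/-- Two edges cross in the drawing `Γ`: they have no common endvertex and the segments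
representing them intersect. -/
def EdgesCross (Γ : StraightLineDrawing V) (e f : Sym2 V) : Prop :=
  (∀ x, x ∈ e → x ∉ f) ∧ (edgeSegment Γ e ∩ edgeSegment Γ f).Nonempty

/-- The drawing obtained from `Γ` by moving the vertex `v` to the point `p`. -/
def moveVertex [DecidableEq V] (Γ : StraightLineDrawing V) (v : V) (p : Plane) :
    StraightLineDrawing V :=
  Function.update Γ v p

open Classical in
/-- The set of edges of `G` that are not crossed by the edge `f` in the drawing `Γ`. -/
noncomputable def uncrossedEdges [Fintype V] [DecidableEq V] (G : SimpleGraph V)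
    [DecidableRel G.Adj] (Γ : StraightLineDrawing V) (f : Sym2 V) : Finset (Sym2 V) :=
  {e ∈ G.edgeFinset | ¬ EdgesCross Γ e f}

/-- The family of all sets of edges not crossed by `uv` in the drawing obtained from `Γ` by moving
`v` to `p`, where `p` ranges over the whole plane. -/
def coFamily [Fintype V] [DecidableEq V] (G : SimpleGraph V) [DecidableRel G.Adj]
    (Γ : StraightLineDrawing V) (u v : V) : Set (Finset (Sym2 V)) :=
  {R | ∃ p : Plane, R = uncrossedEdges G (moveVertex Γ v p) s(u, v)}

end Drawings

section Sampling

variable {α : Type*} [DecidableEq α]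

/-- `S` is a relative `(ε, δ)`-approximation of the set system `(X, F)`. Nonemptiness of `S` makes
the quotient `|S ∩ R| / |S|` meaningful. -/
def IsRelativeApprox (X : Finset α) (F : Set (Finset α)) (ε δ : ℝ) (S : Finset α) : Prop :=
  S ⊆ X ∧ S.Nonempty ∧ ∀ R ∈ F,
    |((S ∩ R).card : ℝ) / (S.card : ℝ) - (R.card : ℝ) / (X.card : ℝ)|
      ≤ δ * max ((R.card : ℝ) / (X.card : ℝ)) ε

open Classical in
/-- The probability that a uniformly random `m`-element subset `S` of `X` satisfies `A`
(meaningful for `m ≤ |X|`). -/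
noncomputable def uniformSampleProb (X : Finset α) (m : ℕ) (A : Finset α → Prop) : ℝ :=
  (((X.powersetCard m).filter A).card : ℝ) / ((X.powersetCard m).card : ℝ)

end Sampling

open Finset

/-! Fix `u`. The segment `up` meets an edge `ab` exactly when `p` lies in the shadow of `ab` seen
from `u`, an intersection of three closed half-planes (`exists_halfplanes_shadow`). So an edge
disjoint from `uv` is uncrossed iff one of three affine functions of `p` is positive. These
functions live in a three-dimensional space, so a single half-plane system shatters at most three
elements, and Sauer–Shelah yields the cubic trace bound `PolyTraces`. Nothing more about drawings is
used.

The rest is a sampling theorem for families with few traces. Compare the sample `S` with a second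
random `m`-set `S'` disjoint from it. Match the two sets in pairs: exchanging partners by random
signs does not change the distribution, so the difference between the two counts of a range is a
Rademacher sum. A plain union bound over traces would cost a factor `log m`; instead, ranges are
grouped by size into dyadic classes, and each class is handled by chaining through nets whose size
comes from a packing bound (`PolyTraces.card_pairDiscrepancy_gt_le`). The cost is then only `log
ε⁻¹`.

If `S` misrepresents a range, then by Chebyshev `S'` represents the remaining part well with
probability at least one half, and the halves disagree (`halves_gap`). This needs `2 * m ≤ |E|`. A
larger sample that is bad passes its badness to at least half of its `⌊|E|/2⌋`-subsets, which
reduces it to the first case.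

A union bound over the neighbours of `v` finishes. The condition `ε * γ ≤ η` keeps `log ε⁻¹ + log
γ⁻¹` away from zero, so that additive constants can be absorbed into `C`. -/

/-! ### Geometry: shadows of segments -/

theorem segment_inter_nonempty_iff (u p a b : Plane) :
    (segment ℝ a b ∩ segment ℝ u p).Nonempty ↔
      ∃ t s : ℝ, 0 ≤ t ∧ t ≤ 1 ∧ 0 ≤ s ∧ s ≤ 1 ∧
        ∀ i, t * (p i - u i) = (1 - s) * (a i - u i) + s * (b i - u i) := by
  simp only [segment_eq_image, Set.Nonempty, Set.mem_inter_iff, Set.mem_image, Set.mem_Icc]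
  constructor
  · rintro ⟨x, ⟨s, ⟨hs0, hs1⟩, hs⟩, ⟨t, ⟨ht0, ht1⟩, ht⟩⟩
    refine ⟨t, s, ht0, ht1, hs0, hs1, fun i => ?_⟩
    have h := congrArg (fun y : Plane => y i) (hs.trans ht.symm)
    simp only [PiLp.add_apply, PiLp.smul_apply, smul_eq_mul] at h
    linarith
  · rintro ⟨t, s, ht0, ht1, hs0, hs1, h⟩
    refine ⟨_, ⟨s, ⟨hs0, hs1⟩, rfl⟩, ⟨t, ⟨ht0, ht1⟩, ?_⟩⟩
    ext i
    simp only [PiLp.add_apply, PiLp.smul_apply, smul_eq_mul]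
    linarith [h i]

/-- In coordinates centred at one endpoint, the set of points whose segment to the origin meets a
given segment is an intersection of three closed half-planes. -/
theorem exists_halfplanes_shadow (a0 a1 b0 b1 : ℝ) :
    ∃ c : Fin 3 → Fin 3 → ℝ, ∀ x y : ℝ,
      (∃ t s : ℝ, 0 ≤ t ∧ t ≤ 1 ∧ 0 ≤ s ∧ s ≤ 1 ∧ t * x = (1 - s) * a0 + s * b0 ∧
        t * y = (1 - s) * a1 + s * b1) ↔ ∀ i, c i 0 + c i 1 * x + c i 2 * y ≤ 0 := by
  have key : ∀ a0 a1 b0 b1 : ℝ,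
      (0 < a0 * b1 - a1 * b0 ∨
        (a0 * b1 - a1 * b0 = 0 ∧ a0 * a0 + a1 * a1 ≤ b0 * b0 + b1 * b1)) →
      ∃ c : Fin 3 → Fin 3 → ℝ, ∀ x y : ℝ,
      (∃ t s : ℝ, 0 ≤ t ∧ t ≤ 1 ∧ 0 ≤ s ∧ s ≤ 1 ∧ t * x = (1 - s) * a0 + s * b0 ∧
        t * y = (1 - s) * a1 + s * b1) ↔ ∀ i, c i 0 + c i 1 * x + c i 2 * y ≤ 0 := by
    intro a0 a1 b0 b1 h
    rcases h with hD | ⟨hD, hle⟩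
    · set D := a0 * b1 - a1 * b0 with hDdef
      -- The shadow is the cone spanned by `a` and `b`, cut off by the line `ab`: one row for each
      -- of these three lines.
      refine ⟨![![0, a1, -a0], ![0, -b1, b0], ![D, a1 - b1, b0 - a0]], fun x y => ?_⟩
      simp only [Fin.forall_fin_succ, Fin.isValue, Matrix.cons_val_zero, Matrix.cons_val_one,
        Matrix.cons_val, Fin.succ_zero_eq_one, Fin.succ_one_eq_two, IsEmpty.forall_iff, and_true]
      constructor
      · rintro ⟨t, s, ht0, ht1, hs0, hs1, hx, hy⟩
        have e1 : t * (a0 * y - a1 * x) = s * D := by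
          rw [hDdef]; linear_combination a0 * hy - a1 * hx
        have e2 : t * (x * b1 - y * b0) = (1 - s) * D := by
          rw [hDdef]; linear_combination b1 * hx - b0 * hy
        have htpos : 0 < t := by
          rcases ht0.lt_or_eq with h | h
          · exact h
          · rw [← h] at e1 e2
            nlinarith
        have p1 : 0 ≤ a0 * y - a1 * x := by
          by_contra! hneg
          nlinarith [mul_nonneg hs0 hD.le, mul_neg_of_pos_of_neg htpos hneg]
        have p2 : 0 ≤ x * b1 - y * b0 := by
          by_contra! hneg
          nlinarith [mul_nonneg (sub_nonneg.2 hs1) hD.le, mul_neg_of_pos_of_neg htpos hneg]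
        refine ⟨by linarith, by linarith, ?_⟩
        nlinarith [mul_nonneg (sub_nonneg.2 ht1) (add_nonneg p1 p2)]
      · rintro ⟨h1, h2, h3⟩
        set Q := (a0 * y - a1 * x) + (x * b1 - y * b0) with hQ
        have hQD : D ≤ Q := by rw [hQ]; linarith
        have hQ0 : 0 < Q := hD.trans_le hQD
        -- Forced values: the identities `e1` and `e2` above add up to `t * Q = D`.
        refine ⟨D / Q, (a0 * y - a1 * x) / Q, by positivity, (div_le_one hQ0).2 hQD,
          div_nonneg (by linarith) hQ0.le, (div_le_one hQ0).2 (by rw [hQ]; linarith), ?_, ?_⟩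
        · field_simp
          rw [hDdef, hQ]; ring
        · field_simp
          rw [hDdef, hQ]; ring
    -- Degenerate case: `a`, `b` and the origin are collinear. If the origin lies on `ab`, then `t =
    -- 0` always works and the shadow is the whole plane; otherwise it is the ray from the nearer
    -- endpoint `a` away from the origin.
    · by_cases h0 : ∃ s : ℝ, 0 ≤ s ∧ s ≤ 1 ∧ (1 - s) * a0 + s * b0 = 0 ∧
          (1 - s) * a1 + s * b1 = 0
      · obtain ⟨s, hs0, hs1, e0, e1⟩ := h0
        refine ⟨0, fun x y => ?_⟩
        simp only [Pi.zero_apply, zero_mul, add_zero, le_refl, implies_true, iff_true]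
        exact ⟨0, s, le_rfl, zero_le_one, hs0, hs1, by linarith, by linarith⟩
      · have ha : 0 < a0 * a0 + a1 * a1 := by
          by_contra! hneg
          apply h0
          have : a0 = 0 := by nlinarith
          have : a1 = 0 := by nlinarith
          exact ⟨0, le_rfl, zero_le_one, by simp [*], by simp [*]⟩
        set N := a0 * a0 + a1 * a1 with hN
        set κ := (a0 * b0 + a1 * b1) / N with hκ
        have hκN : κ * N = a0 * b0 + a1 * b1 := by rw [hκ]; field_simp
        have hb0 : b0 = κ * a0 := by
          rw [hκ]; field_simp; rw [hN]; linear_combination (-a1) * hD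
        have hb1 : b1 = κ * a1 := by
          rw [hκ]; field_simp; rw [hN]; linear_combination a0 * hD
        have hκ0 : 0 < κ := by
          by_contra! hneg
          apply h0
          have hp : 0 < 1 - κ := by linarith
          refine ⟨1 / (1 - κ), by positivity, (div_le_one hp).2 (by linarith), ?_, ?_⟩
          · rw [hb0]; field_simp; ring
          · rw [hb1]; field_simp; ring
        have hκ1 : 1 ≤ κ := by
          by_contra! hlt
          rw [hb0, hb1] at hle
          have : κ * κ < 1 := by nlinarith
          nlinarith
        refine ⟨![![0, a1, -a0], ![0, -a1, a0], ![N, -a0, -a1]], fun x y => ?_⟩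
        simp only [Fin.forall_fin_succ, Fin.isValue, Matrix.cons_val_zero, Matrix.cons_val_one,
          Matrix.cons_val, Fin.succ_zero_eq_one, Fin.succ_one_eq_two, IsEmpty.forall_iff, and_true]
        constructor
        · rintro ⟨t, s, ht0, ht1, hs0, hs1, hx, hy⟩
          set ρ := (1 - s) + s * κ with hρ
          have hρ1 : 1 ≤ ρ := by rw [hρ]; nlinarith
          have hx' : t * x = ρ * a0 := by rw [hx, hb0, hρ]; ring
          have hy' : t * y = ρ * a1 := by rw [hy, hb1, hρ]; ring
          have e1 : t * (a0 * y - a1 * x) = 0 := by linear_combination a0 * hy' - a1 * hx'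
          have e2 : t * (a0 * x + a1 * y) = ρ * N := by
            rw [hN]; linear_combination a0 * hx' + a1 * hy'
          have htpos : 0 < t := by
            rcases ht0.lt_or_eq with h | h
            · exact h
            · rw [← h] at e2
              nlinarith
          have e3 : a0 * y - a1 * x = 0 := by
            rcases mul_eq_zero.1 e1 with h | h
            · exact absurd h htpos.ne'
            · exact h
          refine ⟨by linarith, by linarith, ?_⟩
          have : 0 ≤ a0 * x + a1 * y := by
            by_contra! hneg
            nlinarith [mul_neg_of_pos_of_neg htpos hneg]
          nlinarith
        · rintro ⟨h1, h2, h3⟩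
          set Q := a0 * x + a1 * y with hQ
          have hQN : N ≤ Q := by linarith
          have hQ0 : 0 < Q := ha.trans_le hQN
          have hc : a0 * y = a1 * x := by linarith
          refine ⟨N / Q, 0, by positivity, (div_le_one hQ0).2 hQN, le_rfl, zero_le_one, ?_, ?_⟩
          · field_simp; rw [hN, hQ]; linear_combination (-a1) * hc
          · field_simp; rw [hN, hQ]; linear_combination a0 * hc
  by_cases h : 0 < a0 * b1 - a1 * b0 ∨
        (a0 * b1 - a1 * b0 = 0 ∧ a0 * a0 + a1 * a1 ≤ b0 * b0 + b1 * b1)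
  · exact key a0 a1 b0 b1 h
  · have h' : 0 < b0 * a1 - b1 * a0 ∨
        (b0 * a1 - b1 * a0 = 0 ∧ b0 * b0 + b1 * b1 ≤ a0 * a0 + a1 * a1) := by
      simp only [not_or, not_lt, not_and, not_le] at h
      rcases h.1.lt_or_eq with h1 | h1
      · left; linarith
      · right; exact ⟨by linarith, (h.2 h1).le⟩
    obtain ⟨c, hc⟩ := key b0 b1 a0 a1 h'
    refine ⟨c, fun x y => (Iff.trans ?_ (hc x y))⟩
    constructor
    · rintro ⟨t, s, h1, h2, h3, h4, h5, h6⟩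
      exact ⟨t, 1 - s, h1, h2, by linarith, by linarith, by linarith, by linarith⟩
    · rintro ⟨t, s, h1, h2, h3, h4, h5, h6⟩
      exact ⟨t, 1 - s, h1, h2, by linarith, by linarith, by linarith, by linarith⟩

theorem exists_halfplanes_segment_inter (u a b : Plane) :
    ∃ g : Fin 3 → Fin 3 → ℝ, ∀ p : Plane,
      (segment ℝ a b ∩ segment ℝ u p).Nonempty ↔ ∀ i, ∑ j, g i j * ![1, p 0, p 1] j ≤ 0 := by
  obtain ⟨c, hc⟩ := exists_halfplanes_shadow (a 0 - u 0) (a 1 - u 1) (b 0 - u 0) (b 1 - u 1)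
  refine ⟨fun i => ![c i 0 - c i 1 * u 0 - c i 2 * u 1, c i 1, c i 2], fun p => ?_⟩
  rw [segment_inter_nonempty_iff]
  have h := hc (p 0 - u 0) (p 1 - u 1)
  simp only [Fin.forall_fin_two]
  refine h.trans (forall_congr' fun i => ?_)
  simp only [Fin.sum_univ_three, Matrix.cons_val_zero, Matrix.cons_val_one, Matrix.cons_val]
  constructor <;> intro h <;> linarith

/-! ### Trace bounds from half-planes -/

/-- The traces of the family `F` on a set of `s` points number at most `(3 s + 1) ^ 3`. -/
def PolyTraces {α : Type*} [DecidableEq α] (F : Finset (Finset α)) : Prop :=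
  ∀ Y : Finset α, (F.image (· ∩ Y)).card ≤ (3 * Y.card + 1) ^ 3

/-- Four vectors in `ℝ³` satisfy a nontrivial linear relation with some positive coefficient. A
half-space cutting out exactly the positive coefficients would make every term of the relation,
paired with its normal, nonnegative and one term positive, although the sum is zero. -/
theorem card_le_three_of_shatters {β : Type*} [DecidableEq β] (g : β → Fin 3 → ℝ)
    (𝒜 : Finset (Finset β)) (B : Finset β)
    (h𝒜 : ∀ A ∈ 𝒜, ∃ w : Fin 3 → ℝ, ∀ x ∈ B, x ∈ A ↔ 0 < ∑ j, g x j * w j)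
    (T : Finset β) (hTB : T ⊆ B) (hT : 𝒜.Shatters T) : T.card ≤ 3 := by
  by_contra! hcard
  have hdep : ¬ LinearIndepOn ℝ g (T : Set β) := by
    intro hli
    have := hli.fintype_card_le_finrank
    simp at this
    omega
  rw [linearIndepOn_finset_iff] at hdep
  push Not at hdep
  obtain ⟨f, hf, x0, hx0, hne⟩ := hdep
  have main : ∀ f : β → ℝ, ∑ i ∈ T, f i • g i = 0 → (∃ x ∈ T, 0 < f x) → False := by
    rintro f hf ⟨x, hx, hpos⟩
    obtain ⟨A, hA, hAT⟩ := hT (t := T.filter (fun i => 0 < f i)) (filter_subset _ _)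
    obtain ⟨w, hw⟩ := h𝒜 A hA
    have hmem : ∀ i ∈ T, (0 < f i ↔ 0 < ∑ j, g i j * w j) := by
      intro i hi
      rw [← hw i (hTB hi)]
      have := Finset.ext_iff.1 hAT i
      simp only [mem_inter, hi, true_and, mem_filter] at this
      exact this.symm
    have hsum : ∑ i ∈ T, f i * ∑ j, g i j * w j = 0 := by
      have : ∀ j, ∑ i ∈ T, f i * g i j = 0 := by
        intro j
        have := congrFun hf j
        simpa using this
      calc ∑ i ∈ T, f i * ∑ j, g i j * w j = ∑ j, (∑ i ∈ T, f i * g i j) * w j := by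
            simp only [Finset.mul_sum, Finset.sum_mul]
            rw [Finset.sum_comm]
            exact sum_congr rfl fun _ _ => sum_congr rfl fun _ _ => by ring
        _ = 0 := by simp [this]
    have hpos' : 0 < ∑ i ∈ T, f i * ∑ j, g i j * w j := by
      refine sum_pos' (fun i hi => ?_) ⟨x, hx, mul_pos hpos ((hmem x hx).1 hpos)⟩
      by_cases h : 0 < f i
      · exact (mul_pos h ((hmem i hi).1 h)).le
      · have h2 : ¬ 0 < ∑ j, g i j * w j := fun h' => h ((hmem i hi).2 h')
        exact mul_nonneg_of_nonpos_of_nonpos (not_lt.1 h) (not_lt.1 h2)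
    exact hpos'.ne' hsum
  rcases lt_or_gt_of_ne hne with h | h
  · exact main (fun i => - f i) (by simpa using hf) ⟨x0, hx0, by simpa using h⟩
  · exact main f hf ⟨x0, hx0, h⟩

theorem card_filter_powerset_card_le_three {β : Type*} [DecidableEq β] (B : Finset β) :
    (B.powerset.filter (fun T => T.card ≤ 3)).card ≤ (B.card + 1) ^ 3 := by
  have hsub : B.powerset.filter (fun T => T.card ≤ 3) ⊆
      (range 4).biUnion (fun k => B.powersetCard k) := by
    intro T hT
    simp only [mem_filter, mem_powerset] at hT
    simp only [mem_biUnion, mem_range, mem_powersetCard]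
    exact ⟨T.card, by omega, hT.1, rfl⟩
  calc _ ≤ _ := card_le_card hsub
    _ ≤ ∑ k ∈ range 4, (B.powersetCard k).card := card_biUnion_le
    _ ≤ ∑ k ∈ range 4, B.card ^ k := by
        refine sum_le_sum fun k _ => ?_
        rw [card_powersetCard]
        exact Nat.choose_le_pow _ _
    _ ≤ (B.card + 1) ^ 3 := by
        simp only [sum_range_succ, range_zero, sum_empty]
        nlinarith

/-- Each point is replaced by three copies, one for each functional. A trace on `Y` is then the
projection of a half-space trace on `3 * Y.card` points, and the latter are counted by shattered
sets. -/
theorem polyTraces_of_halfplanes {α : Type*} [DecidableEq α] (F : Finset (Finset α))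
    (g : α → Fin 3 → Fin 3 → ℝ)
    (hF : ∀ R ∈ F, ∃ w : Fin 3 → ℝ, ∀ x, x ∈ R ↔ ∃ i, 0 < ∑ j, g x i j * w j) :
    PolyTraces F := by
  classical
  intro Y
  choose! w hw using hF
  set B : Finset (α × Fin 3) := Y ×ˢ univ with hB
  have hBcard : B.card = 3 * Y.card := by
    rw [hB, card_product]; simp [mul_comm]
  let H : Finset α → Finset (α × Fin 3) :=
    fun R => B.filter (fun z => 0 < ∑ j, g z.1 z.2 j * w R j)
  set 𝒜 := F.image H with h𝒜
  have h1 : (F.image (· ∩ Y)).card ≤ 𝒜.card := by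
    have : F.image (· ∩ Y) = 𝒜.image (fun A => A.image Prod.fst) := by
      rw [h𝒜, image_image]
      refine image_congr fun R hR => ?_
      ext x
      simp only [mem_inter, Function.comp, H, mem_image, mem_filter, hB, mem_product, mem_univ,
        and_true, Prod.exists, exists_and_right, exists_eq_right]
      rw [hw R hR x]
      constructor
      · rintro ⟨⟨i, hi⟩, hx⟩
        exact ⟨i, hx, hi⟩
      · rintro ⟨i, hx, hi⟩
        exact ⟨⟨i, hi⟩, hx⟩
    rw [this]
    exact card_image_le
  have h2 : 𝒜.shatterer ⊆ B.powerset.filter (fun T => T.card ≤ 3) := by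
    intro T hT
    rw [mem_shatterer] at hT
    have hTB : T ⊆ B := by
      obtain ⟨A, hA, hTA⟩ := hT.exists_superset
      obtain ⟨R, _, rfl⟩ := mem_image.1 hA
      exact hTA.trans (filter_subset _ _)
    rw [mem_filter, mem_powerset]
    refine ⟨hTB, card_le_three_of_shatters (fun z => g z.1 z.2) 𝒜 B ?_ T hTB hT⟩
    intro A hA
    obtain ⟨R, _, rfl⟩ := mem_image.1 hA
    exact ⟨w R, fun x hx => by simp [H, hx]⟩
  calc _ ≤ 𝒜.card := h1
    _ ≤ 𝒜.shatterer.card := card_le_card_shatterer 𝒜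
    _ ≤ _ := card_le_card h2
    _ ≤ (B.card + 1) ^ 3 := card_filter_powerset_card_le_three B
    _ = _ := by rw [hBcard]

theorem exists_halfplanes_uncrossedEdges {V : Type*} [Fintype V] [DecidableEq V]
    (G : SimpleGraph V) [DecidableRel G.Adj] (Γ : StraightLineDrawing V) {u v : V} (huv : u ≠ v) :
    ∃ g : Sym2 V → Fin 3 → Fin 3 → ℝ, ∀ (p : Plane) (e : Sym2 V),
      e ∈ uncrossedEdges G (moveVertex Γ v p) s(u, v) ↔
        ∃ i, 0 < ∑ j, g e i j * ![1, p 0, p 1] j := by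
  classical
  have : ∀ e : Sym2 V, ∃ g : Fin 3 → Fin 3 → ℝ, ∀ p : Plane,
      e ∈ uncrossedEdges G (moveVertex Γ v p) s(u, v) ↔
        ∃ i, 0 < ∑ j, g i j * ![1, p 0, p 1] j := by
    intro e
    by_cases he : e ∈ G.edgeFinset
    swap
    · refine ⟨0, fun p => ?_⟩
      simp only [uncrossedEdges, mem_filter, he, false_and]
      simp
    by_cases hdis : ∀ x, x ∈ e → x ∉ s(u, v)
    swap
    -- An edge sharing an endvertex with `uv` is never crossed, so the functional is the positive
    -- constant.
    · refine ⟨fun _ => ![1, 0, 0], fun p => ?_⟩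
      refine iff_of_true ?_ ⟨0, by simp [Fin.sum_univ_three]⟩
      rw [uncrossedEdges, mem_filter]
      exact ⟨he, fun h => hdis h.1⟩
    induction e using Sym2.ind with
    | _ a b =>
      obtain ⟨g, hg⟩ := exists_halfplanes_segment_inter (Γ u) (Γ a) (Γ b)
      refine ⟨g, fun p => ?_⟩
      have ha : a ≠ v := fun h => hdis a (by simp) (by simp [h])
      have hb : b ≠ v := fun h => hdis b (by simp) (by simp [h])
      simp only [uncrossedEdges, mem_filter, he, EdgesCross, true_and, edgeSegment_mk]
      rw [and_iff_right hdis]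
      simp only [moveVertex, Function.update_self, Function.update_of_ne ha,
        Function.update_of_ne hb, Function.update_of_ne huv]
      rw [hg p]
      push Not
      rfl
  choose g hg using this
  exact ⟨g, fun p e => hg e p⟩

theorem exists_polyTraces_coFamily {V : Type*} [Fintype V] [DecidableEq V]
    (G : SimpleGraph V) [DecidableRel G.Adj] (Γ : StraightLineDrawing V) {u v : V} (huv : u ≠ v) :
    ∃ F : Finset (Finset (Sym2 V)), PolyTraces F ∧ (∀ R ∈ F, R ⊆ G.edgeFinset) ∧
      coFamily G Γ u v = F := by
  classical
  have hsub : ∀ R ∈ coFamily G Γ u v, R ⊆ G.edgeFinset := by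
    rintro R ⟨p, rfl⟩
    exact filter_subset _ _
  have hfin : (coFamily G Γ u v).Finite :=
    (G.edgeFinset.powerset.finite_toSet).subset fun R hR =>
      mem_coe.2 (mem_powerset.2 (hsub R hR))
  refine ⟨hfin.toFinset, ?_, fun R hR => hsub R (by simpa using hR), by simp⟩
  obtain ⟨g, hg⟩ := exists_halfplanes_uncrossedEdges G Γ huv
  refine polyTraces_of_halfplanes _ g fun R hR => ?_
  obtain ⟨p, rfl⟩ := (hfin.mem_toFinset).1 hR
  exact ⟨_, fun e => hg p e⟩

/-! ### Packing and nets in the symmetric-difference metric -/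

section Packing

variable {β : Type*} [DecidableEq β]

/-- Greedy choice: each unseparated pair differs in at least `r` of the at most `q * r` points of
`T`, so by averaging some point separates a `1 / q` fraction of the remaining pairs. -/
theorem exists_separating_points (P : Finset (Finset β)) (T : Finset β) {q r : ℝ} (hr : 0 < r)
    (hq : 1 ≤ q) (hT : (T.card : ℝ) ≤ q * r) (hPT : ∀ A ∈ P, A ⊆ T)
    (hsep : ∀ A ∈ P, ∀ B ∈ P, A ≠ B → r ≤ ((symmDiff A B).card : ℝ)) (s : ℕ) :
    ∃ Y : Finset β, Y.card ≤ s ∧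
      (((P ×ˢ P).filter (fun z => z.1 ≠ z.2 ∧ z.1 ∩ Y = z.2 ∩ Y)).card : ℝ) ≤
        (P.card : ℝ) ^ 2 * (1 - 1 / q) ^ s := by
  have hq0 : 0 < q := by linarith
  induction s with
  | zero =>
    refine ⟨∅, le_rfl, ?_⟩
    have := card_filter_le (P ×ˢ P) (fun z => z.1 ≠ z.2 ∧ z.1 ∩ (∅ : Finset β) = z.2 ∩ ∅)
    rw [card_product] at this
    rw [pow_zero, mul_one, pow_two]
    exact_mod_cast this
  | succ s ih =>
    obtain ⟨Y, hY, hle⟩ := ih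
    set U := (P ×ˢ P).filter (fun z => z.1 ≠ z.2 ∧ z.1 ∩ Y = z.2 ∩ Y) with hU
    have h1q : 0 ≤ 1 - 1 / q := by
      rw [sub_nonneg, div_le_one hq0]; exact hq
    rcases U.eq_empty_or_nonempty with hemp | hne
    · refine ⟨Y, by omega, ?_⟩
      rw [← hU, hemp, card_empty, Nat.cast_zero]
      positivity
    have hdc : r * U.card ≤ ∑ x ∈ T, ((U.filter (fun z => x ∈ symmDiff z.1 z.2)).card : ℝ) := by
      have e : ∑ x ∈ T, ((U.filter (fun z => x ∈ symmDiff z.1 z.2)).card : ℝ) =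
          ∑ z ∈ U, ((T.filter (fun x => x ∈ symmDiff z.1 z.2)).card : ℝ) := by
        simp only [card_filter, Nat.cast_sum]
        exact sum_comm
      rw [e, mul_comm, ← nsmul_eq_mul]
      refine card_nsmul_le_sum _ _ _ fun z hz => ?_
      simp only [hU, mem_filter, mem_product] at hz
      refine (hsep _ hz.1.1 _ hz.1.2 hz.2.1).trans ?_
      refine Nat.cast_le.2 (card_le_card fun x hx => mem_filter.2 ⟨?_, hx⟩)
      rcases mem_symmDiff.1 hx with h | h
      · exact hPT _ hz.1.1 h.1
      · exact hPT _ hz.1.2 h.1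
    have hUpos : (0 : ℝ) < U.card := by exact_mod_cast hne.card_pos
    obtain ⟨x, -, hx⟩ : ∃ x ∈ T, (U.card : ℝ) / q ≤
        ((U.filter (fun z => x ∈ symmDiff z.1 z.2)).card : ℝ) := by
      refine exists_le_of_sum_le ?_ (le_trans ?_ hdc)
      · rw [nonempty_iff_ne_empty]
        rintro rfl
        simp only [sum_empty] at hdc
        have := mul_pos hr hUpos
        linarith
      · rw [sum_const, nsmul_eq_mul]
        calc (T.card : ℝ) * (U.card / q) ≤ q * r * (U.card / q) := by gcongr
          _ = r * U.card := by field_simp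
    refine ⟨insert x Y, (card_insert_le _ _).trans (by omega), ?_⟩
    have hsub : (P ×ˢ P).filter (fun z => z.1 ≠ z.2 ∧ z.1 ∩ insert x Y = z.2 ∩ insert x Y) ⊆
        U.filter (fun z => ¬ x ∈ symmDiff z.1 z.2) := by
      intro z hz
      simp only [mem_filter, hU] at hz ⊢
      obtain ⟨hz1, hz2, hz3⟩ := hz
      have hmem : ∀ y ∈ insert x Y, (y ∈ z.1 ↔ y ∈ z.2) := by
        intro y hy
        have := Finset.ext_iff.1 hz3 y
        simpa only [mem_inter, hy, and_true] using this
      refine ⟨⟨hz1, hz2, ?_⟩, ?_⟩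
      · ext y
        simp only [mem_inter]
        exact and_congr_left fun hy => hmem y (mem_insert_of_mem hy)
      · have := hmem x (mem_insert_self _ _)
        rw [mem_symmDiff]
        tauto
    have hsplit := card_filter_add_card_filter_not (s := U) (fun z => x ∈ symmDiff z.1 z.2)
    have hsplit' : ((U.filter (fun z => x ∈ symmDiff z.1 z.2)).card : ℝ) +
        ((U.filter (fun z => ¬ x ∈ symmDiff z.1 z.2)).card : ℝ) = U.card := by
      exact_mod_cast hsplit
    calc _ ≤ ((U.filter (fun z => ¬ x ∈ symmDiff z.1 z.2)).card : ℝ) :=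
          Nat.cast_le.2 (card_le_card hsub)
      _ ≤ U.card * (1 - 1 / q) := by
          rw [mul_sub, mul_one, mul_one_div]; linarith
      _ ≤ (P.card : ℝ) ^ 2 * (1 - 1 / q) ^ s * (1 - 1 / q) := by gcongr
      _ = _ := by rw [pow_succ]; ring

/-- A packing bound for set systems with polynomially many traces. -/
theorem PolyTraces.card_le_of_separated {P : Finset (Finset β)} (hP : PolyTraces P)
    (T : Finset β) {q r : ℝ} (hr : 0 < r)
    (hq : 1 ≤ q) (hT : (T.card : ℝ) ≤ q * r) (hPT : ∀ A ∈ P, A ⊆ T)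
    (hsep : ∀ A ∈ P, ∀ B ∈ P, A ≠ B → r ≤ ((symmDiff A B).card : ℝ)) :
    (P.card : ℝ) ≤ (40 * q) ^ 6 := by
  have hq0 : 0 < q := by linarith
  rcases P.eq_empty_or_nonempty with rfl | hne
  · simp; positivity
  have hM1 : (1 : ℝ) ≤ P.card := by exact_mod_cast hne.card_pos
  obtain ⟨M, hM⟩ : ∃ M : ℝ, M = P.card := ⟨_, rfl⟩
  rw [← hM] at hM1 ⊢
  have hM0 : 0 < M := by linarith
  -- With this many points the number of unseparated pairs drops below one, so all members have
  -- distinct traces on `Y`.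
  set s : ℕ := ⌊2 * q * Real.log M⌋₊ + 1 with hs
  obtain ⟨Y, hY, hle⟩ := exists_separating_points P T hr hq hT hPT hsep s
  rw [← hM] at hle
  have hlog0 : 0 ≤ Real.log M := Real.log_nonneg hM1
  have hslow : 2 * q * Real.log M < s := by
    rw [hs]; push_cast; exact Nat.lt_floor_add_one _
  have hsup : (s : ℝ) ≤ 2 * q * Real.log M + 1 := by
    rw [hs]; push_cast
    have := Nat.floor_le (a := 2 * q * Real.log M) (by positivity)
    linarith
  have hlt : M ^ 2 * (1 - 1 / q) ^ s < 1 := by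
    have h1q : 0 ≤ 1 - 1 / q := by
      rw [sub_nonneg, div_le_one hq0]; exact hq
    have h1 : (1 - 1 / q) ^ s ≤ Real.exp (-(1 / q)) ^ s := by
      gcongr
      exact Real.one_sub_le_exp_neg _
    rw [← Real.exp_nat_mul] at h1
    have h2 : Real.exp (s * -(1 / q)) < Real.exp (-(2 * Real.log M)) := by
      rw [Real.exp_lt_exp, mul_neg, neg_lt_neg_iff, mul_one_div, lt_div_iff₀ hq0]
      linarith
    have h3 : Real.exp (-(2 * Real.log M)) = (M ^ 2)⁻¹ := by
      rw [Real.exp_neg, two_mul, Real.exp_add, Real.exp_log hM0, pow_two]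
    rw [h3] at h2
    calc M ^ 2 * (1 - 1 / q) ^ s < M ^ 2 * (M ^ 2)⁻¹ := by
          gcongr
          exact h1.trans_lt h2
      _ = 1 := by field_simp
  have hcard0 : ((P ×ˢ P).filter (fun z => z.1 ≠ z.2 ∧ z.1 ∩ Y = z.2 ∩ Y)).card = 0 := by
    have : (((P ×ˢ P).filter (fun z => z.1 ≠ z.2 ∧ z.1 ∩ Y = z.2 ∩ Y)).card : ℝ) < 1 :=
      hle.trans_lt hlt
    have : ((P ×ˢ P).filter (fun z => z.1 ≠ z.2 ∧ z.1 ∩ Y = z.2 ∩ Y)).card < 1 := by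
      exact_mod_cast this
    omega
  have hinj : Set.InjOn (· ∩ Y) (P : Set (Finset β)) := by
    intro A hA B hB hAB
    by_contra hne
    rw [card_eq_zero] at hcard0
    have : (A, B) ∈ (P ×ˢ P).filter (fun z => z.1 ≠ z.2 ∧ z.1 ∩ Y = z.2 ∩ Y) :=
      mem_filter.2 ⟨mem_product.2 ⟨hA, hB⟩, hne, hAB⟩
    rw [hcard0] at this
    simp at this
  have hbound : M ≤ (3 * s + 1) ^ 3 := by
    have h1 := hP Y
    rw [card_image_of_injOn hinj] at h1
    have h2 : P.card ≤ (3 * s + 1) ^ 3 := h1.trans (by gcongr)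
    rw [hM]
    exact_mod_cast h2
  -- The bound `M ≤ (3 * s + 1) ^ 3`, with `s` of order `q * log M`, is solved for `M` using `log M
  -- ≤ 6 * y`; it becomes `y ^ 6 ≤ (40 * q * y) ^ 3`.
  set y : ℝ := M ^ (1 / 6 : ℝ) with hy
  have hy1 : 1 ≤ y := Real.one_le_rpow hM1 (by norm_num)
  have hy6 : y ^ 6 = M := by
    rw [hy, ← Real.rpow_natCast, ← Real.rpow_mul hM0.le]
    norm_num
  have hlogy : Real.log M ≤ 6 * y := by
    rw [← hy6, Real.log_pow]
    have := Real.log_le_sub_one_of_pos (by linarith : 0 < y)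
    push_cast
    linarith
  have h40 : (3 * s + 1 : ℝ) ≤ 40 * q * y := by
    have h1 : q * Real.log M ≤ q * (6 * y) := by gcongr
    have h2 : 1 ≤ q * y := by nlinarith
    nlinarith
  have hy40 : y ≤ 40 * q := by
    have h1 : y ^ 6 ≤ (40 * q * y) ^ 3 := by
      rw [hy6]
      exact hbound.trans (by gcongr)
    have h2 : y ^ 3 ≤ (40 * q) ^ 3 := by
      have hy3 : 0 < y ^ 3 := by positivity
      refine le_of_mul_le_mul_right ?_ hy3
      calc y ^ 3 * y ^ 3 = y ^ 6 := by ring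
        _ ≤ _ := h1
        _ = _ := by ring
    exact le_of_pow_le_pow_left₀ (by norm_num) (by positivity) h2
  rw [← hy6]
  gcongr

theorem PolyTraces.mono {F F' : Finset (Finset β)} (hF : PolyTraces F) (h : F' ⊆ F) :
    PolyTraces F' := fun Y => (card_le_card (image_subset_image h)).trans (hF Y)

/-- A maximal `r`-separated subfamily is a net, and packing bounds its size. -/
theorem PolyTraces.exists_net {F : Finset (Finset β)} (hF : PolyTraces F)
    (T : Finset β) (hFT : ∀ A ∈ F, A ⊆ T) {q r : ℝ} (hr : 0 < r)
    (hq : 1 ≤ q) (hT : (T.card : ℝ) ≤ q * r) :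
    ∃ N ⊆ F, (N.card : ℝ) ≤ (40 * q) ^ 6 ∧
      ∀ R ∈ F, ∃ A ∈ N, ((symmDiff R A).card : ℝ) ≤ r := by
  classical
  let good : Finset (Finset (Finset β)) := F.powerset.filter
    (fun N => ∀ A ∈ N, ∀ B ∈ N, A ≠ B → r ≤ ((symmDiff A B).card : ℝ))
  obtain ⟨N, hN, hmax⟩ := exists_max_image good card ⟨∅, by simp [good]⟩
  simp only [good, mem_filter, mem_powerset] at hN hmax
  refine ⟨N, hN.1, (hF.mono hN.1).card_le_of_separated T hr hq hT
    (fun A hA => hFT A (hN.1 hA)) hN.2, fun R hR => ?_⟩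
  by_contra! hfar
  have hRN : R ∉ N := by
    intro h
    have := hfar R h
    simp at this
    linarith
  have := hmax (insert R N) ⟨insert_subset hR hN.1, ?_⟩
  · rw [card_insert_of_notMem hRN] at this
    omega
  · intro A hA B hB hAB
    rcases mem_insert.1 hA with rfl | hA' <;> rcases mem_insert.1 hB with rfl | hB'
    · exact absurd rfl hAB
    · exact (hfar B hB').le
    · rw [symmDiff_comm]; exact (hfar A hA').le
    · exact hN.2 A hA' B hB' hAB

end Packing

/-! ### Rademacher sums and numerical estimates -/

section Rademacher

variable {ι : Type*} [Fintype ι] [DecidableEq ι]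

/-- The sign encoded by a boolean. -/
def boolSign (b : Bool) : ℝ := if b then 1 else -1

theorem sum_exp_signs_le (c : ι → ℝ) (θ : ℝ) :
    ∑ s : ι → Bool, Real.exp (θ * ∑ i, boolSign (s i) * c i) ≤
      2 ^ Fintype.card ι * Real.exp (θ ^ 2 * (∑ i, c i ^ 2) / 2) := by
  have h1 : ∑ s : ι → Bool, Real.exp (θ * ∑ i, boolSign (s i) * c i) =
      ∏ i, ∑ b : Bool, Real.exp (θ * (boolSign b * c i)) := by
    rw [prod_univ_sum, Fintype.piFinset_univ]
    refine sum_congr rfl fun s _ => ?_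
    rw [mul_sum, Real.exp_sum]
  have h2 : ∀ i, ∑ b : Bool, Real.exp (θ * (boolSign b * c i)) ≤
      2 * Real.exp (θ ^ 2 * c i ^ 2 / 2) := by
    intro i
    have := Real.cosh_le_exp_half_sq (θ * c i)
    rw [Real.cosh_eq, mul_pow] at this
    simp only [Fintype.sum_bool, boolSign, if_true, one_mul]
    simp only [Bool.false_eq_true, if_false, neg_mul, one_mul, mul_neg]
    linarith
  rw [h1]
  calc _ ≤ ∏ i, (2 * Real.exp (θ ^ 2 * c i ^ 2 / 2)) :=
        prod_le_prod (fun i _ => sum_nonneg fun _ _ => (Real.exp_pos _).le) fun i _ => h2 i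
    _ = _ := by
        rw [prod_mul_distrib, prod_const, card_univ, ← Real.exp_sum, mul_sum, sum_div]

/-- Hoeffding's inequality for Rademacher sums, in counting form. -/
theorem card_signs_abs_gt_le (c : ι → ℝ) {a V : ℝ} (ha : 0 ≤ a) (hV : 0 < V)
    (hc : ∑ i, c i ^ 2 ≤ V) :
    ((univ.filter (fun s : ι → Bool => a < |∑ i, boolSign (s i) * c i|)).card : ℝ) ≤
      2 ^ Fintype.card ι * (2 * Real.exp (-(a ^ 2 / (2 * V)))) := by
  have one : ∀ c : ι → ℝ, ∑ i, c i ^ 2 ≤ V →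
      ((univ.filter (fun s : ι → Bool => a < ∑ i, boolSign (s i) * c i)).card : ℝ) ≤
      2 ^ Fintype.card ι * Real.exp (-(a ^ 2 / (2 * V))) := by
    intro c hc
    -- The minimizer of the Chernoff exponent `θ ^ 2 * V / 2 - θ * a`.
    set θ := a / V with hθ
    have hθ0 : 0 ≤ θ := by positivity
    have h1 : ((univ.filter (fun s : ι → Bool => a < ∑ i, boolSign (s i) * c i)).card : ℝ) *
        Real.exp (θ * a) ≤ ∑ s : ι → Bool, Real.exp (θ * ∑ i, boolSign (s i) * c i) := by
      rw [← nsmul_eq_mul]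
      refine (card_nsmul_le_sum _ _ _ fun s hs => ?_).trans
        (sum_le_sum_of_subset_of_nonneg (filter_subset _ _) fun _ _ _ => (Real.exp_pos _).le)
      have := (mem_filter.1 hs).2
      exact Real.exp_le_exp.2 (by gcongr)
    have h2 := h1.trans (sum_exp_signs_le c θ)
    rw [← le_div_iff₀ (Real.exp_pos _), mul_div_assoc, ← Real.exp_sub] at h2
    refine h2.trans ?_
    gcongr
    calc θ ^ 2 * (∑ i, c i ^ 2) / 2 - θ * a ≤ θ ^ 2 * V / 2 - θ * a := by gcongr
      _ = -(a ^ 2 / (2 * V)) := by rw [hθ]; field_simp; ring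
  have hsub : univ.filter (fun s : ι → Bool => a < |∑ i, boolSign (s i) * c i|) ⊆
      univ.filter (fun s : ι → Bool => a < ∑ i, boolSign (s i) * c i) ∪
      univ.filter (fun s : ι → Bool => a < ∑ i, boolSign (s i) * (- c i)) := by
    intro s hs
    simp only [mem_filter, mem_univ, true_and, mem_union, mul_neg, sum_neg_distrib] at hs ⊢
    exact lt_abs.1 hs
  have h1 := one c hc
  have h2 := one (fun i => - c i) (by simpa using hc)
  have h3 := (card_le_card hsub).trans (card_union_le _ _)
  have h4 : ((univ.filter (fun s : ι → Bool => a < |∑ i, boolSign (s i) * c i|)).card : ℝ) ≤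
      (univ.filter (fun s : ι → Bool => a < ∑ i, boolSign (s i) * c i)).card +
      (univ.filter (fun s : ι → Bool => a < ∑ i, boolSign (s i) * (- c i))).card := by
    exact_mod_cast h3
  linarith

/-- The signed sum over the pairs `(i, true), (i, false)` of the indicator function of `R`. -/
def pairDiscrepancy (R : Finset (ι × Bool)) (s : ι → Bool) : ℝ :=
  ∑ i, boolSign (s i) * ((if (i, true) ∈ R then 1 else 0) - (if (i, false) ∈ R then 1 else 0))

theorem pairDiscrepancy_empty (s : ι → Bool) : pairDiscrepancy ∅ s = 0 := by
  simp [pairDiscrepancy]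

/-- Increments are subgaussian for the symmetric-difference metric: a pair with `n ≤ 2` points in
`symmDiff A B` has coefficient at most `n` in absolute value, with square at most `2 * n`. -/
theorem card_pairDiscrepancy_sub_gt_le (A B : Finset (ι × Bool)) {a V : ℝ} (ha : 0 ≤ a)
    (hV : 0 < V) (hAB : 2 * ((symmDiff A B).card : ℝ) ≤ V) :
    ((univ.filter (fun s : ι → Bool => a < |pairDiscrepancy A s - pairDiscrepancy B s|)).card : ℝ)
      ≤ 2 ^ Fintype.card ι * (2 * Real.exp (-(a ^ 2 / (2 * V)))) := by
  set c : ι → ℝ := fun i =>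
    ((if (i, true) ∈ A then 1 else 0) - (if (i, false) ∈ A then 1 else 0)) -
    ((if (i, true) ∈ B then 1 else 0) - (if (i, false) ∈ B then 1 else 0)) with hc
  have h : ∀ s : ι → Bool, pairDiscrepancy A s - pairDiscrepancy B s =
      ∑ i, boolSign (s i) * c i := by
    intro s
    rw [pairDiscrepancy, pairDiscrepancy, ← sum_sub_distrib]
    exact sum_congr rfl fun i _ => by rw [hc]; ring
  simp only [h]
  refine card_signs_abs_gt_le c ha hV (le_trans ?_ hAB)
  have hcard : ((symmDiff A B).card : ℝ) =
      ∑ i : ι, ∑ b : Bool, if (i, b) ∈ symmDiff A B then (1 : ℝ) else 0 := by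
    rw [← Fintype.sum_prod_type' (f := fun i b => if (i, b) ∈ symmDiff A B then (1 : ℝ) else 0)]
    simp
  rw [hcard, mul_sum]
  refine sum_le_sum fun i _ => ?_
  simp only [hc, Fintype.sum_bool, mem_symmDiff]
  by_cases h1 : (i, true) ∈ A <;> by_cases h2 : (i, false) ∈ A <;>
    by_cases h3 : (i, true) ∈ B <;> by_cases h4 : (i, false) ∈ B <;>
    simp [h1, h2, h3, h4] <;> norm_num

theorem sum_range_half_pow_succ_le (J : ℕ) : ∑ j ∈ range J, (1 / 2 : ℝ) ^ (j + 1) ≤ 1 := by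
  have : ∑ j ∈ range J, (1 / 2 : ℝ) ^ (j + 1) = 1 - (1 / 2 : ℝ) ^ J := by
    induction J with
    | zero => simp
    | succ J ih => rw [sum_range_succ, ih]; ring
  rw [this]
  have : (0 : ℝ) ≤ (1 / 2) ^ J := by positivity
  linarith

theorem sum_range_three_quarters_pow_le (J : ℕ) : ∑ j ∈ range J, (3 / 4 : ℝ) ^ j ≤ 4 := by
  have : ∑ j ∈ range J, (3 / 4 : ℝ) ^ j = 4 - 4 * (3 / 4 : ℝ) ^ J := by
    induction J with
    | zero => simp
    | succ J ih => rw [sum_range_succ, ih]; ring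
  rw [this]
  have : (0 : ℝ) ≤ (3 / 4) ^ J := by positivity
  linarith

theorem exp_neg_natCast_le (j : ℕ) : Real.exp (-(j : ℝ)) ≤ (1 / 2 : ℝ) ^ j := by
  have h : Real.exp (-(1 : ℝ)) ≤ 1 / 2 := by
    rw [Real.exp_neg, inv_eq_one_div]
    have := Real.add_one_le_exp (1 : ℝ)
    exact one_div_le_one_div_of_le (by norm_num) (by linarith)
  calc Real.exp (-(j : ℝ)) = Real.exp (-1) ^ j := by
        rw [← Real.exp_nat_mul]; congr 1; ring
    _ ≤ _ := by gcongr

theorem net_size_le {ε Λ : ℝ} (hε : 0 < ε) (hΛ : 1 ≤ Λ) (hεΛ : ε⁻¹ ≤ Real.exp Λ) (j : ℕ) :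
    (40 * (2 ^ (j + 2) / ε)) ≤ Real.exp (7 * Λ * (1 + j)) := by
  have h1 : (160 : ℝ) ≤ Real.exp 6 := by
    have h := Real.exp_one_gt_d9
    have : Real.exp 6 = Real.exp 1 ^ 6 := by rw [← Real.exp_nat_mul]; norm_num
    rw [this]
    calc (160 : ℝ) ≤ 2.7 ^ 6 := by norm_num
      _ ≤ _ := by gcongr; linarith
  have h2 : (2 : ℝ) ^ j ≤ Real.exp j := by
    have : Real.exp j = Real.exp 1 ^ j := by rw [← Real.exp_nat_mul]; norm_num
    rw [this]
    have := Real.add_one_le_exp (1 : ℝ)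
    gcongr
    linarith
  calc (40 * (2 ^ (j + 2) / ε)) = 160 * 2 ^ j * ε⁻¹ := by rw [pow_add]; field_simp; ring
    _ ≤ Real.exp 6 * Real.exp j * Real.exp Λ := by gcongr
    _ = Real.exp (6 + j + Λ) := by rw [Real.exp_add, Real.exp_add]
    _ ≤ _ := by
      gcongr
      have : (0 : ℝ) ≤ j := by positivity
      nlinarith

theorem one_add_div_le_pow (j : ℕ) : (1 + j) / 8 ≤ (9 / 8 : ℝ) ^ j := by
  have h := one_add_mul_le_pow (a := (1 / 8 : ℝ)) (by norm_num) j
  norm_num at h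
  linarith

/-- The probability that a step of the chain is too long, at one scale. -/
theorem chain_step_exponent {δ t κ Λ : ℝ} (hκ : 1 ≤ κ) (hΛ : 1 ≤ Λ) (ht : 0 < t)
    (h : 352256 * (κ * Λ) ≤ δ ^ 2 * t) (j : ℕ) :
    84 * Λ * (1 + j) + -((δ * t / 8 * (3 / 4) ^ j) ^ 2 / (2 * (4 * t / 2 ^ j))) ≤
      -(κ * Λ) + -((j + 1 : ℕ) : ℝ) := by
  have e : (δ * t / 8 * (3 / 4) ^ j) ^ 2 / (2 * (4 * t / 2 ^ j)) =
      δ ^ 2 * t * (9 / 8) ^ j / 512 := by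
    have : (9 / 8 : ℝ) ^ j = ((3 / 4) ^ j) ^ 2 * 2 ^ j := by
      rw [← pow_mul, mul_comm j 2, pow_mul, ← mul_pow]; norm_num
    rw [this]
    field_simp
    ring
  have h1 := one_add_div_le_pow j
  -- Here `352256 = 512 * 8 * 86`, and `86 = 84 + 1 + 1` pays for the net sizes, for `κ * Λ` and for
  -- the summable term `j + 1`.
  have h2 : 352256 * (κ * Λ) * ((1 + j) / 8) ≤ δ ^ 2 * t * (9 / 8) ^ j := by gcongr
  rw [e]
  push_cast
  have hj : (0 : ℝ) ≤ j := by positivity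
  have h3 : Λ ≤ κ * Λ := by nlinarith
  have h4 : Λ * (1 + j) ≤ κ * Λ * (1 + j) := by gcongr
  have h5 : κ * Λ ≤ κ * Λ * (1 + j) := by nlinarith
  have h6 : (1 + j : ℝ) ≤ κ * Λ * (1 + j) := by nlinarith
  linarith

end Rademacher

/-! ### Chaining and peeling by size -/

section Chaining

variable {ι : Type*} [Fintype ι] [DecidableEq ι]

/-- Chaining for the ranges of size at most `t`. -/
theorem PolyTraces.card_pairDiscrepancy_gt_le_of_card_le {F : Finset (Finset (ι × Bool))}
    (hF : PolyTraces F) {ε δ t κ Λ : ℝ} (hε : 0 < ε) (hε1 : ε ≤ 1) (hδ : 0 < δ) (hκ : 1 ≤ κ)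
    (hΛ : 1 ≤ Λ) (hεΛ : ε⁻¹ ≤ Real.exp Λ) (ht : 0 < t) (htε : ε * Fintype.card ι ≤ t)
    (h : 352256 * (κ * Λ) ≤ δ ^ 2 * t) :
    ((univ.filter (fun s : ι → Bool =>
      ∃ R ∈ F, (R.card : ℝ) ≤ t ∧ δ * t / 2 < |pairDiscrepancy R s|)).card : ℝ) ≤
      2 ^ Fintype.card ι * (2 * Real.exp (-(κ * Λ))) := by
  classical
  set F' := F.filter (fun R => (R.card : ℝ) ≤ t) with hF'
  have hnet : ∀ j : ℕ, ∃ N : Finset (Finset (ι × Bool)), (j = 0 → N = {∅}) ∧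
      (N.card : ℝ) ≤ (40 * (2 ^ (j + 1) / ε)) ^ 6 ∧
      ∀ R ∈ F', ∃ A ∈ N, ((symmDiff R A).card : ℝ) ≤ t / 2 ^ j := by
    intro j
    have hq : (1 : ℝ) ≤ 2 ^ (j + 1) / ε := by
      rw [le_div_iff₀ hε]
      have : (1 : ℝ) ≤ 2 ^ (j + 1) := one_le_pow₀ (by norm_num)
      linarith
    -- At scale `0` the empty set alone is a net, because the ranges have size at most `t`; its
    -- discrepancy is zero, so every chain starts at zero.
    rcases Nat.eq_zero_or_pos j with rfl | hj
    · refine ⟨{∅}, fun _ => rfl, ?_, fun R hR => ⟨∅, by simp, ?_⟩⟩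
      · rw [card_singleton, Nat.cast_one]
        exact one_le_pow₀ (by linarith)
      · have := (mem_filter.1 hR).2
        simpa [symmDiff_def] using this
    · obtain ⟨N, -, hN1, hN2⟩ := (hF.mono (filter_subset _ _) : PolyTraces F').exists_net univ
        (fun A _ => subset_univ A) (r := t / 2 ^ j) (by positivity) hq (by
          rw [card_univ, Fintype.card_prod, Fintype.card_bool]
          push_cast
          rw [pow_succ]
          field_simp
          linarith)
      exact ⟨N, fun h => absurd h hj.ne', hN1, hN2⟩
  choose N hN0 hNcard hNcover using hnet
  choose! π hπN hπ using hNcover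
  -- Below distance one the approximation is exact, so the chain stops after finitely many steps.
  obtain ⟨J, hJ⟩ : ∃ J : ℕ, t / 2 ^ J < 1 := by
    obtain ⟨J, hJ⟩ := pow_unbounded_of_one_lt t (by norm_num : (1 : ℝ) < 2)
    exact ⟨J, by rwa [div_lt_one (by positivity)]⟩
  -- Allowed step lengths: their sum is at most `δ * t / 2`, while `a j ^ 2` divided by the variance
  -- `4 * t / 2 ^ j` still grows like `(9 / 8) ^ j`, beating the linear growth of the log net size.
  set a : ℕ → ℝ := fun j => δ * t / 8 * (3 / 4) ^ j with ha
  set pairs : ℕ → Finset (Finset (ι × Bool) × Finset (ι × Bool)) := fun j =>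
    (N (j + 1) ×ˢ N j).filter (fun z => ((symmDiff z.1 z.2).card : ℝ) ≤ 2 * t / 2 ^ j) with hpairs
  set bad : Finset (ι × Bool) × Finset (ι × Bool) → ℝ → Finset (ι → Bool) := fun z b =>
    univ.filter (fun s => b < |pairDiscrepancy z.1 s - pairDiscrepancy z.2 s|) with hbad
  have hsub : univ.filter (fun s : ι → Bool =>
      ∃ R ∈ F, (R.card : ℝ) ≤ t ∧ δ * t / 2 < |pairDiscrepancy R s|) ⊆
      (range J).biUnion (fun j => (pairs j).biUnion (fun z => bad z (a j))) := by
    intro s hs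
    by_contra hns
    obtain ⟨R, hR, hRt, hRs⟩ := (mem_filter.1 hs).2
    have hRF : R ∈ F' := mem_filter.2 ⟨hR, hRt⟩
    have hstep : ∀ j < J,
        |pairDiscrepancy (π (j + 1) R) s - pairDiscrepancy (π j R) s| ≤ a j := by
      intro j hj
      by_contra! hgt
      apply hns
      simp only [mem_biUnion, mem_range]
      refine ⟨j, hj, (π (j + 1) R, π j R), ?_, ?_⟩
      · simp only [hpairs, mem_filter, mem_product]
        refine ⟨⟨hπN _ _ hRF, hπN _ _ hRF⟩, ?_⟩
        have h1 := hπ (j + 1) R hRF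
        have h2 := hπ j R hRF
        have h3 : ((symmDiff (π (j + 1) R) (π j R)).card : ℝ) ≤
            (symmDiff R (π (j + 1) R)).card + (symmDiff R (π j R)).card := by
          rw [symmDiff_comm R (π (j + 1) R)]
          exact_mod_cast (card_le_card (symmDiff_triangle (π (j + 1) R) R (π j R))).trans
            (card_union_le _ _)
        have h4 : t / 2 ^ (j + 1) ≤ t / 2 ^ j := by
          gcongr
          · norm_num
          · omega
        rw [mul_div_assoc]
        linarith
      · exact mem_filter.2 ⟨mem_univ _, hgt⟩
    have hsum : ∀ j ≤ J, |pairDiscrepancy (π j R) s| ≤ ∑ i ∈ range j, a i := by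
      intro j
      induction j with
      | zero =>
        intro _
        have : π 0 R = ∅ := by
          have := hπN 0 R hRF
          rw [hN0 0 rfl] at this
          exact mem_singleton.1 this
        simp [this, pairDiscrepancy_empty]
      | succ j ih =>
        intro hj
        rw [sum_range_succ]
        have h1 := ih (by omega)
        have h2 := hstep j (by omega)
        have h3 := abs_add_le (pairDiscrepancy (π (j + 1) R) s - pairDiscrepancy (π j R) s)
          (pairDiscrepancy (π j R) s)
        rw [sub_add_cancel] at h3
        linarith
    have hRJ : π J R = R := by
      have h1 := (hπ J R hRF).trans_lt hJ
      have h2 : (symmDiff R (π J R)).card < 1 := by exact_mod_cast h1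
      have h3 : symmDiff R (π J R) = ∅ := card_eq_zero.1 (by omega)
      exact (symmDiff_eq_bot.1 h3).symm
    have h1 := hsum J le_rfl
    rw [hRJ, ha, ← mul_sum] at h1
    have h2 := sum_range_three_quarters_pow_le J
    have h3 : δ * t / 8 * ∑ i ∈ range J, (3 / 4 : ℝ) ^ i ≤ δ * t / 8 * 4 := by gcongr
    linarith
  have hbadcard : ∀ j, ∀ z ∈ pairs j, ((bad z (a j)).card : ℝ) ≤
      2 ^ Fintype.card ι * (2 * Real.exp (-((a j) ^ 2 / (2 * (4 * t / 2 ^ j))))) := by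
    intro j z hz
    refine card_pairDiscrepancy_sub_gt_le z.1 z.2 (by positivity) (by positivity) ?_
    have := (mem_filter.1 hz).2
    calc _ ≤ 2 * (2 * t / 2 ^ j) := by gcongr
      _ = _ := by ring
  have hpaircard : ∀ j, ((pairs j).card : ℝ) ≤ Real.exp (84 * Λ * (1 + j)) := by
    intro j
    have h1 : ((pairs j).card : ℝ) ≤ (N (j + 1)).card * (N j).card := by
      have : (pairs j).card ≤ (N (j + 1) ×ˢ N j).card := card_filter_le _ _
      rw [card_product] at this
      exact_mod_cast this
    have h2 : (40 * (2 ^ (j + 1) / ε)) ^ 6 ≤ (40 * (2 ^ (j + 2) / ε)) ^ 6 := by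
      gcongr
      · norm_num
      · omega
    calc ((pairs j).card : ℝ) ≤ (40 * (2 ^ (j + 2) / ε)) ^ 6 * (40 * (2 ^ (j + 2) / ε)) ^ 6 :=
          h1.trans (mul_le_mul (hNcard (j + 1)) ((hNcard j).trans h2) (by positivity)
            (by positivity))
      _ = (40 * (2 ^ (j + 2) / ε)) ^ 12 := by ring
      _ ≤ Real.exp (7 * Λ * (1 + j)) ^ 12 := by
          gcongr
          exact net_size_le hε hΛ hεΛ j
      _ = _ := by rw [← Real.exp_nat_mul]; congr 1; push_cast; ring
  have hlevel : ∀ j, ((((pairs j).biUnion (fun z => bad z (a j))).card : ℕ) : ℝ) ≤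
      2 ^ Fintype.card ι * (2 * Real.exp (-(κ * Λ))) * (1 / 2) ^ (j + 1) := by
    intro j
    calc _ ≤ ∑ z ∈ pairs j, ((bad z (a j)).card : ℝ) := by exact_mod_cast card_biUnion_le
      _ ≤ (pairs j).card •
          (2 ^ Fintype.card ι * (2 * Real.exp (-((a j) ^ 2 / (2 * (4 * t / 2 ^ j)))))) :=
          sum_le_card_nsmul _ _ _ (hbadcard j)
      _ ≤ Real.exp (84 * Λ * (1 + j)) *
          (2 ^ Fintype.card ι * (2 * Real.exp (-((a j) ^ 2 / (2 * (4 * t / 2 ^ j)))))) := by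
          rw [nsmul_eq_mul]
          gcongr
          exact hpaircard j
      _ = 2 ^ Fintype.card ι * (2 * Real.exp (84 * Λ * (1 + j) +
          -((a j) ^ 2 / (2 * (4 * t / 2 ^ j))))) := by rw [Real.exp_add]; ring
      _ ≤ 2 ^ Fintype.card ι * (2 * Real.exp (-(κ * Λ) + -((j + 1 : ℕ) : ℝ))) := by
          exact mul_le_mul_of_nonneg_left (mul_le_mul_of_nonneg_left
            (Real.exp_le_exp.2 (chain_step_exponent hκ hΛ ht h j)) (by norm_num)) (by positivity)
      _ = 2 ^ Fintype.card ι * (2 * Real.exp (-(κ * Λ))) * Real.exp (-((j + 1 : ℕ) : ℝ)) := by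
          rw [Real.exp_add]; ring
      _ ≤ _ := by
          gcongr
          exact exp_neg_natCast_le (j + 1)
  calc _ ≤ ((((range J).biUnion
        (fun j => (pairs j).biUnion (fun z => bad z (a j)))).card : ℕ) : ℝ) :=
        Nat.cast_le.2 (card_le_card hsub)
    _ ≤ ∑ j ∈ range J, ((((pairs j).biUnion (fun z => bad z (a j))).card : ℕ) : ℝ) := by
        exact_mod_cast card_biUnion_le
    _ ≤ ∑ j ∈ range J,
        2 ^ Fintype.card ι * (2 * Real.exp (-(κ * Λ))) * (1 / 2) ^ (j + 1) :=
        sum_le_sum fun j _ => hlevel j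
    _ ≤ 2 ^ Fintype.card ι * (2 * Real.exp (-(κ * Λ))) * 1 := by
        rw [← mul_sum]
        gcongr
        exact sum_range_half_pow_succ_le J
    _ = _ := mul_one _

/-- With high probability, random signs give small relative discrepancy for all ranges. -/
theorem PolyTraces.card_pairDiscrepancy_gt_le {F : Finset (Finset (ι × Bool))}
    (hF : PolyTraces F) {ε δ Λ : ℝ} (hε : 0 < ε) (hε1 : ε ≤ 1) (hδ : 0 < δ)
    (hΛ : 1 ≤ Λ) (hεΛ : ε⁻¹ ≤ Real.exp Λ)
    (h : 352256 * Λ ≤ Fintype.card ι * (ε * δ ^ 2)) :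
    ((univ.filter (fun s : ι → Bool => ∃ R ∈ F,
      δ * max (R.card : ℝ) (ε * Fintype.card ι) < |pairDiscrepancy R s|)).card : ℝ) ≤
      2 ^ Fintype.card ι * (4 * Real.exp (-Λ)) := by
  classical
  obtain ⟨m, hm⟩ : ∃ m : ℝ, m = Fintype.card ι := ⟨_, rfl⟩
  rw [← hm] at h ⊢
  have hm0 : 0 < m := by
    by_contra! hneg
    have : 0 < ε * δ ^ 2 := by positivity
    nlinarith
  -- Dyadic size classes with `t = 2 ^ i * (ε * m)`. Chaining is applied with `κ = 2 ^ i`, so the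
  -- failure probabilities are summable over `i`.
  set bad : ℕ → Finset (ι → Bool) := fun i => univ.filter (fun s : ι → Bool =>
      ∃ R ∈ F, (R.card : ℝ) ≤ 2 ^ i * (ε * m) ∧
        δ * (2 ^ i * (ε * m)) / 2 < |pairDiscrepancy R s|) with hbad
  obtain ⟨I, hI⟩ : ∃ I : ℕ, 2 * m ≤ 2 ^ I * (ε * m) := by
    obtain ⟨I, hI⟩ := pow_unbounded_of_one_lt (2 / ε) (by norm_num : (1 : ℝ) < 2)
    refine ⟨I, ?_⟩
    rw [div_lt_iff₀ hε] at hI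
    nlinarith
  have hsub : univ.filter (fun s : ι → Bool => ∃ R ∈ F,
      δ * max (R.card : ℝ) (ε * m) < |pairDiscrepancy R s|) ⊆
      (range (I + 1)).biUnion bad := by
    intro s hs
    obtain ⟨R, hR, hRs⟩ := (mem_filter.1 hs).2
    have hRI : (R.card : ℝ) ≤ 2 ^ I * (ε * m) := by
      refine le_trans ?_ hI
      have := card_le_univ R
      rw [Fintype.card_prod, Fintype.card_bool] at this
      rw [hm, mul_comm]
      exact_mod_cast this
    have hex : ∃ i : ℕ, (R.card : ℝ) ≤ 2 ^ i * (ε * m) := ⟨I, hRI⟩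
    have hfind : Nat.find hex ≤ I := Nat.find_min' hex hRI
    simp only [mem_biUnion, mem_range]
    -- By minimality of the class, `t / 2` is at most `max |R| (ε * m)`; this is why chaining is
    -- stated with the threshold `δ * t / 2`.
    refine ⟨Nat.find hex, by omega, mem_filter.2 ⟨mem_univ _, R, hR, Nat.find_spec hex, ?_⟩⟩
    refine lt_of_le_of_lt ?_ hRs
    rw [mul_div_assoc]
    gcongr
    rcases Nat.eq_zero_or_pos (Nat.find hex) with h0 | hpos
    · rw [h0, pow_zero, one_mul]
      have : 0 < ε * m := by positivity
      exact le_max_of_le_right (by linarith)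
    · have hlt := Nat.find_min hex (Nat.sub_lt hpos one_pos)
      rw [not_le] at hlt
      refine le_max_of_le_left (le_trans (le_of_eq ?_) hlt.le)
      obtain ⟨k, hk⟩ := Nat.exists_eq_succ_of_ne_zero hpos.ne'
      rw [hk, Nat.succ_sub_one, pow_succ]
      ring
  have hlevel : ∀ i, ((bad i).card : ℝ) ≤
      2 ^ Fintype.card ι * (4 * Real.exp (-Λ)) * (1 / 2) ^ (i + 1) := by
    intro i
    have h2i : (1 : ℝ) ≤ 2 ^ i := one_le_pow₀ (by norm_num)
    have h1 := hF.card_pairDiscrepancy_gt_le_of_card_le (t := 2 ^ i * (ε * m)) hε hε1 hδ h2i hΛ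
      hεΛ (by positivity) (by
        rw [← hm]
        exact le_mul_of_one_le_left (by positivity) h2i) (by
        calc 352256 * (2 ^ i * Λ) = 2 ^ i * (352256 * Λ) := by ring
          _ ≤ 2 ^ i * (m * (ε * δ ^ 2)) := by gcongr
          _ = _ := by ring)
    refine h1.trans ?_
    have h3 : Real.exp (-(2 ^ i * Λ)) ≤ Real.exp (-Λ) * (1 / 2) ^ i := by
      calc Real.exp (-(2 ^ i * Λ)) ≤ Real.exp (-Λ + -(i : ℝ)) := by
            rw [Real.exp_le_exp]
            have h5 : (1 : ℝ) + i ≤ 2 ^ i := by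
              have := one_add_mul_le_pow (a := (1 : ℝ)) (by norm_num) i
              norm_num at this
              exact this
            have h6 : (0 : ℝ) ≤ i := by positivity
            nlinarith
        _ = Real.exp (-Λ) * Real.exp (-(i : ℝ)) := Real.exp_add _ _
        _ ≤ _ := by
            gcongr
            exact exp_neg_natCast_le i
    calc _ ≤ 2 ^ Fintype.card ι * (2 * (Real.exp (-Λ) * (1 / 2) ^ i)) := by gcongr
      _ = _ := by rw [pow_succ]; ring
  calc _ ≤ ((((range (I + 1)).biUnion bad).card : ℕ) : ℝ) := Nat.cast_le.2 (card_le_card hsub)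
    _ ≤ ∑ i ∈ range (I + 1), ((bad i).card : ℝ) := by exact_mod_cast card_biUnion_le
    _ ≤ ∑ i ∈ range (I + 1), 2 ^ Fintype.card ι * (4 * Real.exp (-Λ)) * (1 / 2) ^ (i + 1) :=
        sum_le_sum fun i _ => hlevel i
    _ ≤ 2 ^ Fintype.card ι * (4 * Real.exp (-Λ)) * 1 := by
        rw [← mul_sum]
        gcongr
        exact sum_range_half_pow_succ_le (I + 1)
    _ = _ := mul_one _

end Chaining

/-! ### Symmetrization without replacement -/

section Symmetrization

variable {α : Type*} [DecidableEq α]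

theorem sum_powersetCard_map {α : Type*} (σ : Equiv.Perm α) (Y : Finset α) (m : ℕ) (g : Finset α → ℝ) :
    ∑ S ∈ (Y.map σ.toEmbedding).powersetCard m, g S =
      ∑ S ∈ Y.powersetCard m, g (S.map σ.toEmbedding) := by
  rw [powersetCard_map, sum_map]
  rfl

theorem sum_disjoint_pairs_map (σ : Equiv.Perm α) (X : Finset α) (hσ : X.map σ.toEmbedding = X)
    (m : ℕ) (f : Finset α → Finset α → ℝ) :
    ∑ S ∈ X.powersetCard m, ∑ S' ∈ (X \ S).powersetCard m,
        f (S.map σ.toEmbedding) (S'.map σ.toEmbedding) =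
      ∑ S ∈ X.powersetCard m, ∑ S' ∈ (X \ S).powersetCard m, f S S' := by
  conv_rhs => rw [← hσ]
  rw [sum_powersetCard_map]
  refine sum_congr rfl fun S _ => ?_
  rw [← Finset.map_sdiff, sum_powersetCard_map]

/-- One of the two halves into which the signs `s` split the pairs `w (i, true), w (i, false)`. -/
def signHalf {m : ℕ} (w : Fin m × Bool ↪ α) (s : Fin m → Bool) (b : Bool) : Finset α :=
  univ.image (fun i => w (i, b == s i))

/-- Exchanging the two elements of the pairs with sign `false`. -/
def signFlip {m : ℕ} (s : Fin m → Bool) : Equiv.Perm (Fin m × Bool) where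
  toFun z := (z.1, z.2 == s z.1)
  invFun z := (z.1, z.2 == s z.1)
  left_inv := by
    rintro ⟨i, b⟩
    cases b <;> cases h : s i <;> simp [h]
  right_inv := by
    rintro ⟨i, b⟩
    cases b <;> cases h : s i <;> simp [h]

theorem exists_embedding_pairs {m : ℕ} {S S' : Finset α} (hS : S.card = m) (hS' : S'.card = m)
    (hd : Disjoint S S') :
    ∃ w : Fin m × Bool ↪ α, S = univ.image (fun i => w (i, true)) ∧
      S' = univ.image (fun i => w (i, false)) := by
  let e := S.equivFinOfCardEq hS
  let e' := S'.equivFinOfCardEq hS'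
  have himg : ∀ (S : Finset α) (e : S ≃ Fin m), S = univ.image (fun i => (e.symm i : α)) := by
    intro S e
    ext x
    simp only [mem_image, mem_univ, true_and]
    constructor
    · intro hx
      exact ⟨e ⟨x, hx⟩, by simp⟩
    · rintro ⟨i, rfl⟩
      exact (e.symm i).2
  refine ⟨⟨fun z => if z.2 then (e.symm z.1 : α) else (e'.symm z.1 : α), ?_⟩, ?_, ?_⟩
  · rintro ⟨i, b⟩ ⟨j, c⟩ h
    cases b <;> cases c <;>
      simp only [Bool.false_eq_true, if_true, if_false] at h
    · simpa using e'.symm.injective (Subtype.ext h)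
    · exact absurd h.symm (disjoint_left.1 hd (e.symm j).2 |> fun hh h' =>
        hh (h' ▸ (e'.symm i).2))
    · exact absurd h (disjoint_left.1 hd (e.symm i).2 |> fun hh h' =>
        hh (h' ▸ (e'.symm j).2))
    · simpa using e.symm.injective (Subtype.ext h)
  · exact himg S e
  · exact himg S' e'

/-- To bound the proportion of ordered pairs of disjoint `m`-sets with a property, it is enough to
bound the proportion of sign vectors, for each fixed matching of `2 m` points. -/
theorem sum_disjoint_pairs_le [Fintype α] (X : Finset α) (m : ℕ)
    (f : Finset α → Finset α → ℝ) (p : ℝ)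
    (h : ∀ w : Fin m × Bool ↪ α, ∑ s : Fin m → Bool, f (signHalf w s true) (signHalf w s false) ≤
      2 ^ m * p) :
    ∑ S ∈ X.powersetCard m, ∑ S' ∈ (X \ S).powersetCard m, f S S' ≤
      ∑ S ∈ X.powersetCard m, ∑ _S' ∈ (X \ S).powersetCard m, p := by
  classical
  -- Averaging over the stabilizer of `X` leaves the sum over disjoint pairs unchanged, so it
  -- suffices to bound the orbit sum of each fixed pair.
  set G : Finset (Equiv.Perm α) := univ.filter (fun σ => X.map σ.toEmbedding = X) with hG
  have hGpos : (0 : ℝ) < G.card := by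
    have : (1 : Equiv.Perm α) ∈ G := by
      refine mem_filter.2 ⟨mem_univ _, ?_⟩
      ext x
      simp only [mem_map_equiv]
      rfl
    exact_mod_cast card_pos.2 ⟨_, this⟩
  have hfix : ∀ S ∈ X.powersetCard m, ∀ S' ∈ (X \ S).powersetCard m,
      ∑ σ ∈ G, f (S.map σ.toEmbedding) (S'.map σ.toEmbedding) ≤ G.card * p := by
    intro S hS S' hS'
    rw [mem_powersetCard] at hS hS'
    have hd : Disjoint S S' := disjoint_of_subset_right hS'.1 disjoint_sdiff
    obtain ⟨w, hw, hw'⟩ := exists_embedding_pairs hS.2 hS'.2 hd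
    have hwX : ∀ z, w z ∈ X := by
      rintro ⟨i, b⟩
      cases b
      · refine sdiff_subset (hS'.1 ?_)
        rw [hw']
        exact mem_image_of_mem _ (mem_univ i)
      · refine hS.1 ?_
        rw [hw]
        exact mem_image_of_mem _ (mem_univ i)
    -- Partner swaps extended by the identity; they lie in `G`, so right translation by `τ s`
    -- preserves the orbit sum and one may average over `s`.
    let τ : (Fin m → Bool) → Equiv.Perm α := fun s => (signFlip s).viaFintypeEmbedding w
    have hτw : ∀ s z, τ s (w z) = w (signFlip s z) := fun s z =>
      Equiv.Perm.viaFintypeEmbedding_apply_image _ _ _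
    have hτX : ∀ s, X.map (τ s).toEmbedding = X := by
      intro s
      refine eq_of_subset_of_card_le (fun y hy => ?_) (by rw [card_map])
      obtain ⟨x, hx, rfl⟩ := mem_map.1 hy
      simp only [Equiv.coe_toEmbedding]
      by_cases hxr : x ∈ Set.range w
      · obtain ⟨z, rfl⟩ := hxr
        rw [hτw]
        exact hwX _
      · rw [show τ s x = x from Equiv.Perm.viaFintypeEmbedding_apply_notMem_range _ _ hxr]
        exact hx
    have hmul : ∀ (Y : Finset α) (σ τ : Equiv.Perm α),
        Y.map (σ * τ).toEmbedding = (Y.map τ.toEmbedding).map σ.toEmbedding := by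
      intro Y σ τ
      rw [map_map]
      rfl
    have hshift : ∀ s, ∑ σ ∈ G, f (S.map σ.toEmbedding) (S'.map σ.toEmbedding) =
        ∑ σ ∈ G, f (signHalf (w.trans σ.toEmbedding) s true)
          (signHalf (w.trans σ.toEmbedding) s false) := by
      intro s
      symm
      refine sum_equiv (Equiv.mulRight (τ s)) (fun σ => ?_) (fun σ _ => ?_)
      · simp only [hG, mem_filter, mem_univ, true_and, Equiv.coe_mulRight, hmul, hτX]
      · have hhalf : ∀ b, (univ.image (fun i => w (i, b))).map (σ * τ s).toEmbedding =
            signHalf (w.trans σ.toEmbedding) s b := by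
          intro b
          rw [hmul, map_eq_image, map_eq_image, image_image, image_image, signHalf]
          refine image_congr fun i _ => ?_
          simp only [Function.comp, Equiv.coe_toEmbedding, hτw, Function.Embedding.trans_apply]
          rfl
        simp only [Equiv.coe_mulRight]
        rw [← hhalf, ← hhalf, ← hw, ← hw']
    have h2 : (2 : ℝ) ^ m * ∑ σ ∈ G, f (S.map σ.toEmbedding) (S'.map σ.toEmbedding) ≤
        2 ^ m * (G.card * p) := by
      calc _ = ∑ s : Fin m → Bool, ∑ σ ∈ G, f (signHalf (w.trans σ.toEmbedding) s true)
            (signHalf (w.trans σ.toEmbedding) s false) := by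
            rw [← sum_congr rfl (fun s _ => hshift s), sum_const, card_univ, nsmul_eq_mul]
            simp
        _ = ∑ σ ∈ G, ∑ s : Fin m → Bool, f (signHalf (w.trans σ.toEmbedding) s true)
            (signHalf (w.trans σ.toEmbedding) s false) := sum_comm
        _ ≤ ∑ σ ∈ G, 2 ^ m * p := sum_le_sum fun σ _ => h _
        _ = _ := by rw [sum_const, nsmul_eq_mul]; ring
    exact le_of_mul_le_mul_left h2 (by positivity)
  refine le_of_mul_le_mul_left ?_ hGpos
  calc (G.card : ℝ) * ∑ S ∈ X.powersetCard m, ∑ S' ∈ (X \ S).powersetCard m, f S S'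
      = ∑ σ ∈ G, ∑ S ∈ X.powersetCard m, ∑ S' ∈ (X \ S).powersetCard m,
        f (S.map σ.toEmbedding) (S'.map σ.toEmbedding) := by
        rw [sum_congr rfl (fun σ hσ => sum_disjoint_pairs_map σ X (mem_filter.1 hσ).2 m f),
          sum_const, nsmul_eq_mul]
    _ = ∑ S ∈ X.powersetCard m, ∑ S' ∈ (X \ S).powersetCard m, ∑ σ ∈ G,
        f (S.map σ.toEmbedding) (S'.map σ.toEmbedding) := by
        rw [sum_comm]
        exact sum_congr rfl fun S _ => sum_comm
    _ ≤ ∑ S ∈ X.powersetCard m, ∑ S' ∈ (X \ S).powersetCard m, G.card * p :=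
        sum_le_sum fun S hS => sum_le_sum fun S' hS' => hfix S hS S' hS'
    _ = _ := by simp only [mul_sum]

/-- A pulled-back trace on `Y` depends only on the trace on `Y.image w`, which is no larger than
`Y`. -/
theorem PolyTraces.comap {F : Finset (Finset α)} (hF : PolyTraces F) {β : Type*} [DecidableEq β]
    [Fintype β] (w : β → α) :
    PolyTraces (F.image (fun R => univ.filter (fun z => w z ∈ R))) := by
  intro Y
  have h : (F.image (fun R => univ.filter (fun z => w z ∈ R))).image (· ∩ Y) =
      (F.image (· ∩ Y.image w)).image (fun A => Y.filter (fun z => w z ∈ A)) := by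
    rw [image_image, image_image]
    refine image_congr fun R _ => ?_
    ext z
    simp only [Function.comp, mem_inter, mem_filter, mem_univ, true_and]
    constructor
    · rintro ⟨h1, h2⟩
      exact ⟨h2, h1, mem_image_of_mem _ h2⟩
    · rintro ⟨h2, h1, -⟩
      exact ⟨h1, h2⟩
  rw [h]
  refine card_image_le.trans ((hF _).trans ?_)
  have := card_image_le (s := Y) (f := w)
  gcongr

theorem card_signHalf_inter {m : ℕ} (w : Fin m × Bool ↪ α) (s : Fin m → Bool) (b : Bool)
    (R : Finset α) :
    ((signHalf w s b ∩ R).card : ℝ) = ∑ i, if w (i, b == s i) ∈ R then (1 : ℝ) else 0 := by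
  have hinj : Function.Injective (fun i => w (i, b == s i)) := by
    intro i j hij
    have := w.injective hij
    simp only [Prod.mk.injEq] at this
    exact this.1
  rw [signHalf, ← filter_mem_eq_inter, filter_image, card_image_of_injective _ hinj, card_filter]
  push_cast
  rfl

/-- The two halves of a sample disagree about some range. -/
def HalvesDisagree (F : Finset (Finset α)) (ε δ : ℝ) (S S' : Finset α) : Prop :=
  ∃ R ∈ F, δ * max (((S ∩ R).card : ℝ) + (S' ∩ R).card) (ε * S.card) <
    |((S ∩ R).card : ℝ) - (S' ∩ R).card|

theorem card_signHalf {m : ℕ} (w : Fin m × Bool ↪ α) (s : Fin m → Bool) (b : Bool) :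
    (signHalf w s b).card = m := by
  have hinj : Function.Injective (fun i => w (i, b == s i)) := by
    intro i j hij
    have := w.injective hij
    simp only [Prod.mk.injEq] at this
    exact this.1
  rw [signHalf, card_image_of_injective _ hinj, card_univ, Fintype.card_fin]

open Classical in
/-- A random pair of disjoint `m`-sets disagrees about some range only with small probability. -/
theorem PolyTraces.sum_halvesDisagree_le [Fintype α] {F : Finset (Finset α)} (hF : PolyTraces F)
    {ε δ Λ : ℝ} (hε : 0 < ε) (hε1 : ε ≤ 1) (hδ : 0 < δ)
    (hΛ : 1 ≤ Λ) (hεΛ : ε⁻¹ ≤ Real.exp Λ) {m : ℕ} (h : 352256 * Λ ≤ m * (ε * δ ^ 2))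
    (X : Finset α) :
    ∑ S ∈ X.powersetCard m, ∑ S' ∈ (X \ S).powersetCard m,
        (if HalvesDisagree F ε δ S S' then (1 : ℝ) else 0) ≤
      ∑ S ∈ X.powersetCard m, ∑ _S' ∈ (X \ S).powersetCard m, 4 * Real.exp (-Λ) := by
  refine sum_disjoint_pairs_le X m _ _ fun w => ?_
  have h1 := (hF.comap w).card_pairDiscrepancy_gt_le hε hε1 hδ hΛ hεΛ
    (by rw [Fintype.card_fin]; exact h)
  rw [Fintype.card_fin] at h1
  refine le_trans ?_ h1
  rw [← sum_filter, sum_const, nsmul_eq_mul, mul_one, Nat.cast_le]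
  refine card_le_card fun s hs => ?_
  obtain ⟨R, hR, hlt⟩ := (mem_filter.1 hs).2
  refine mem_filter.2 ⟨mem_univ _, _, mem_image_of_mem _ hR, ?_⟩
  rw [card_signHalf] at hlt
  -- The pulled-back range has `|S ∩ R| + |S' ∩ R|` elements whatever the signs, and its signed sum
  -- is the difference of the two counts.
  convert hlt using 3
  · rw [card_signHalf_inter, card_signHalf_inter, ← sum_add_distrib, card_filter,
      Fintype.sum_prod_type]
    push_cast
    refine sum_congr rfl fun i _ => ?_
    rw [Fintype.sum_bool]
    cases s i
    · simp [add_comm]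
    · simp
  · rw [card_signHalf_inter, card_signHalf_inter, ← sum_sub_distrib, pairDiscrepancy]
    refine sum_congr rfl fun i _ => ?_
    simp only [mem_filter, mem_univ, true_and, boolSign]
    cases s i <;> simp

end Symmetrization

/-! ### Second moments of a random `m`-set -/

section Hypergeometric

variable {α : Type*} [DecidableEq α]

theorem card_powersetCard_filter_mem_mul (Y : Finset α) {m : ℕ} {x : α} (hx : x ∈ Y) :
    ((Y.powersetCard m).filter (fun S => x ∈ S)).card * Y.card = Y.card.choose m * m := by
  rcases Nat.eq_zero_or_pos m with rfl | hm
  · simp [powersetCard_zero, filter_singleton]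
  have h := card_filter_powersetCard_subset {x} Y m (singleton_subset_iff.2 hx) (by rw [card_singleton]; exact hm)
  simp only [singleton_subset_iff, card_singleton] at h
  rw [h]
  have hY : 0 < Y.card := card_pos.2 ⟨x, hx⟩
  obtain ⟨n, hn⟩ := Nat.exists_eq_succ_of_ne_zero hY.ne'
  obtain ⟨k, rfl⟩ := Nat.exists_eq_succ_of_ne_zero hm.ne'
  rw [hn]
  have := Nat.add_one_mul_choose_eq n k
  simp only [Nat.succ_eq_add_one, Nat.add_sub_cancel]
  linarith

/-- Negative correlation: the probability of containing two given points is `m (m - 1) / (n (n - 1))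
≤ (m / n) ^ 2`, where `n = Y.card`. It makes the variance of `|S ∩ R|` at most its mean. -/
theorem card_powersetCard_filter_mem_mem_mul_le (Y : Finset α) {m : ℕ} (hm : m ≤ Y.card) {x y : α}
    (hx : x ∈ Y) (hy : y ∈ Y) (hxy : x ≠ y) :
    ((Y.powersetCard m).filter (fun S => x ∈ S ∧ y ∈ S)).card * Y.card ^ 2 ≤
      Y.card.choose m * m ^ 2 := by
  rcases lt_or_ge m 2 with hm2 | hm2
  · have : (Y.powersetCard m).filter (fun S => x ∈ S ∧ y ∈ S) = ∅ := by
      refine filter_eq_empty_iff.2 fun S hS => ?_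
      rintro ⟨h1, h2⟩
      have h3 : ({x, y} : Finset α) ⊆ S := by
        intro z hz
        rcases mem_insert.1 hz with rfl | hz
        · exact h1
        · rw [mem_singleton.1 hz]; exact h2
      have h4 := card_le_card h3
      rw [card_pair hxy, (mem_powersetCard.1 hS).2] at h4
      omega
    rw [this]
    simp
  have h := card_filter_powersetCard_subset {x, y} Y m
    (insert_subset hx (singleton_subset_iff.2 hy)) (by rw [card_pair hxy]; exact hm2)
  simp only [insert_subset_iff, singleton_subset_iff, card_pair hxy] at h
  rw [h]
  obtain ⟨n, hn⟩ := Nat.exists_eq_add_of_le (hm2.trans hm)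
  obtain ⟨k, rfl⟩ := Nat.exists_eq_add_of_le hm2
  rw [hn] at hm ⊢
  have e1 := Nat.add_one_mul_choose_eq n k
  have e2 := Nat.add_one_mul_choose_eq (n + 1) (k + 1)
  have hkn : k ≤ n := by omega
  rw [Nat.add_sub_cancel_left, Nat.add_sub_cancel_left]
  rw [show 2 + n = n + 1 + 1 by ring, show 2 + k = k + 1 + 1 by ring]
  have e3 : n.choose k * (n + 1 + 1) ≤ (n + 1).choose (k + 1) * (k + 1 + 1) := by
    refine Nat.le_of_mul_le_mul_left ?_ (show 0 < n + 1 by omega)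
    calc (n + 1) * (n.choose k * (n + 1 + 1)) = (n + 1).choose (k + 1) * ((k + 1) * (n + 1 + 1)) :=
          by rw [← mul_assoc, e1]; ring
      _ ≤ (n + 1).choose (k + 1) * ((n + 1) * (k + 1 + 1)) := by
          exact Nat.mul_le_mul_left _ (by nlinarith)
      _ = _ := by ring
  calc n.choose k * (n + 1 + 1) ^ 2 = (n.choose k * (n + 1 + 1)) * (n + 1 + 1) := by ring
    _ ≤ ((n + 1).choose (k + 1) * (k + 1 + 1)) * (n + 1 + 1) := by gcongr
    _ = ((n + 1 + 1) * (n + 1).choose (k + 1)) * (k + 1 + 1) := by ring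
    _ = _ := by rw [e2]; ring

/-- The variance bound for the hypergeometric distribution. -/
theorem sum_sq_card_inter_sub_le (Y R : Finset α) (hR : R ⊆ Y) {m : ℕ} (hm : m ≤ Y.card)
    (hY : 0 < Y.card) :
    ∑ S ∈ Y.powersetCard m, (((S ∩ R).card : ℝ) - m * (R.card / Y.card)) ^ 2 ≤
      (Y.powersetCard m).card * (m * (R.card / Y.card)) := by
  have hY0 : (0 : ℝ) < Y.card := by exact_mod_cast hY
  set n : ℝ := (Y.card : ℝ) with hn
  set c : ℝ := ((Y.powersetCard m).card : ℝ) with hc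
  set r : ℝ := (R.card : ℝ) with hr
  have hind : ∀ S : Finset α, ((S ∩ R).card : ℝ) = ∑ x ∈ R, if x ∈ S then (1 : ℝ) else 0 := by
    intro S
    rw [inter_comm, ← filter_mem_eq_inter, card_filter]
    push_cast
    rfl
  have h1 : ∀ x ∈ R, ∑ S ∈ Y.powersetCard m, (if x ∈ S then (1 : ℝ) else 0) = c * (m / n) := by
    intro x hx
    rw [← sum_filter, sum_const, nsmul_eq_mul, mul_one, mul_div_assoc', eq_div_iff hY0.ne', hc,
      card_powersetCard, hn]
    exact_mod_cast card_powersetCard_filter_mem_mul Y (hR hx)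
  have h2 : ∀ x ∈ R, ∀ y ∈ R, x ≠ y → ∑ S ∈ Y.powersetCard m,
      ((if x ∈ S then (1 : ℝ) else 0) * (if y ∈ S then (1 : ℝ) else 0)) ≤ c * (m / n) ^ 2 := by
    intro x hx y hy hxy
    have : ∀ S : Finset α, ((if x ∈ S then (1 : ℝ) else 0) * (if y ∈ S then (1 : ℝ) else 0)) =
        if x ∈ S ∧ y ∈ S then 1 else 0 := by
      intro S
      by_cases hxS : x ∈ S <;> by_cases hyS : y ∈ S <;> simp [hxS, hyS]
    simp only [this]
    rw [← sum_filter, sum_const, nsmul_eq_mul, mul_one, div_pow, mul_div_assoc',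
      le_div_iff₀ (by positivity), hc, card_powersetCard, hn]
    exact_mod_cast card_powersetCard_filter_mem_mem_mul_le Y hm (hR hx) (hR hy) hxy
  have hc0 : 0 ≤ c := by positivity
  have hm0 : (0 : ℝ) ≤ m := by positivity
  have s1 : ∑ S ∈ Y.powersetCard m, ((S ∩ R).card : ℝ) = r * (c * (m / n)) := by
    simp only [hind]
    rw [sum_comm, sum_congr rfl h1, sum_const, nsmul_eq_mul]
  have s2 : ∑ S ∈ Y.powersetCard m, ((S ∩ R).card : ℝ) ^ 2 ≤
      r * (c * (m / n) + r * (c * (m / n) ^ 2)) := by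
    have e : ∑ S ∈ Y.powersetCard m, ((S ∩ R).card : ℝ) ^ 2 = ∑ x ∈ R, ∑ y ∈ R,
        ∑ S ∈ Y.powersetCard m,
        ((if x ∈ S then (1 : ℝ) else 0) * (if y ∈ S then (1 : ℝ) else 0)) := by
      simp only [hind, pow_two, sum_mul_sum]
      rw [sum_comm]
      exact sum_congr rfl fun x _ => sum_comm
    rw [e, hr, ← nsmul_eq_mul]
    refine sum_le_card_nsmul _ _ _ fun x hx => ?_
    rw [← add_sum_erase R _ hx]
    refine add_le_add (le_of_eq ?_) ?_
    · rw [← h1 x hx]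
      exact sum_congr rfl fun S _ => by split_ifs <;> simp
    · calc _ ≤ (R.erase x).card • (c * (m / n) ^ 2) :=
            sum_le_card_nsmul _ _ _ fun y hy =>
              h2 x hx y (mem_of_mem_erase hy) (ne_of_mem_erase hy).symm
        _ ≤ R.card * (c * (m / n) ^ 2) := by
            rw [nsmul_eq_mul]
            gcongr
            exact erase_subset _ _
  calc _ = ∑ S ∈ Y.powersetCard m, ((S ∩ R).card : ℝ) ^ 2 -
        2 * (m * (r / n)) * ∑ S ∈ Y.powersetCard m, ((S ∩ R).card : ℝ) +
        c * (m * (r / n)) ^ 2 := by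
        have ec : c * (m * (r / n)) ^ 2 = ∑ S ∈ Y.powersetCard m, (m * (r / n)) ^ 2 := by
          rw [sum_const, nsmul_eq_mul]
        rw [mul_sum, ← sum_sub_distrib, ec, ← sum_add_distrib]
        exact sum_congr rfl fun S _ => by ring
    _ ≤ r * (c * (m / n) + r * (c * (m / n) ^ 2)) -
        2 * (m * (r / n)) * (r * (c * (m / n))) + c * (m * (r / n)) ^ 2 := by
        rw [s1]
        gcongr
    _ = _ := by ring

/-- A random `m`-set represents a given range well with probability at least one half. -/
theorem card_far_le_half (Y R : Finset α) (hR : R ⊆ Y) {m : ℕ} (hm : m ≤ Y.card)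
    {ε δ : ℝ} (hε : 0 < ε) (hδ : 0 < δ) (h : 2 ≤ m * (ε * δ ^ 2)) :
    (((Y.powersetCard m).filter (fun S => δ * max ((R.card : ℝ) / Y.card) ε <
      |((S ∩ R).card : ℝ) / m - R.card / Y.card|)).card : ℝ) ≤
      (Y.powersetCard m).card / 2 := by
  have hm0 : (0 : ℝ) < m := by
    by_contra! hneg
    have : 0 < ε * δ ^ 2 := by positivity
    nlinarith
  have hY : 0 < Y.card := lt_of_lt_of_le (by exact_mod_cast hm0) hm
  set ρ : ℝ := (R.card : ℝ) / Y.card with hρ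
  have hρ0 : 0 ≤ ρ := by positivity
  set M := max ρ ε with hM
  have hMε : ε ≤ M := le_max_right _ _
  have hM0 : 0 < M := by linarith
  set bad := (Y.powersetCard m).filter (fun S => δ * M < |((S ∩ R).card : ℝ) / m - ρ|) with hbad
  set c : ℝ := ((Y.powersetCard m).card : ℝ) with hc
  have h1 : (bad.card : ℝ) * (m * (δ * M)) ^ 2 ≤ c * (m * ρ) := by
    refine le_trans ?_ (sum_sq_card_inter_sub_le Y R hR hm hY)
    rw [← nsmul_eq_mul]
    refine (card_nsmul_le_sum bad _ _ fun S hS => ?_).trans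
      (sum_le_sum_of_subset_of_nonneg (filter_subset _ _) fun _ _ _ => sq_nonneg _)
    have h2 := (mem_filter.1 hS).2
    have e : ((S ∩ R).card : ℝ) - m * ρ = m * (((S ∩ R).card : ℝ) / m - ρ) := by
      field_simp
    rw [e, ← sq_abs (m * (((S ∩ R).card : ℝ) / m - ρ)), abs_mul, abs_of_pos hm0]
    gcongr
  -- Chebyshev: the squared threshold `(m * δ * M) ^ 2` is at least twice `m * M`, which bounds the
  -- variance.
  have h2 : (bad.card : ℝ) * (2 * (m * M)) ≤ c * (m * M) := by
    calc (bad.card : ℝ) * (2 * (m * M)) ≤ bad.card * ((m * (ε * δ ^ 2)) * (m * M)) := by gcongr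
      _ ≤ bad.card * ((m * (M * δ ^ 2)) * (m * M)) := by gcongr
      _ = (bad.card : ℝ) * (m * (δ * M)) ^ 2 := by ring
      _ ≤ c * (m * ρ) := h1
      _ ≤ c * (m * M) := by
        gcongr
        exact le_max_left _ _
  have h3 : 0 < m * M := by positivity
  rw [le_div_iff₀ two_pos]
  refine le_of_mul_le_mul_right ?_ h3
  linarith

end Hypergeometric

/-! ### Relative approximation by a random sample -/

section RelativeApproximation

/-- If one half of a sample is far from the truth and the other half is close to the truth on the
rest, then the two halves differ. -/
theorem halves_gap {a b μ ρ l ε δ : ℝ} (ha : 0 ≤ a) (hρ : 0 ≤ ρ) (hl0 : 0 < l)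
    (hl1 : l < 1) (hμ : μ = l * a + (1 - l) * ρ) (hε : 0 < ε) (hδ : 0 < δ) (hδ1 : δ ≤ 1)
    (hb : |b - ρ| ≤ δ / 4 * max ρ ε) (hfar : δ * max μ ε < |a - μ|) :
    δ / 16 * max (a + b) ε < |a - b| := by
  have hl1' : 0 < 1 - l := by linarith
  have hμ0 : 0 ≤ μ := by rw [hμ]; positivity
  set M := max μ ε with hM
  have hμM : μ ≤ M := le_max_left _ _
  have hεM : ε ≤ M := le_max_right _ _
  have hM0 : 0 < M := by linarith
  have hδM : 0 < δ * M := by positivity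
  have hδM1 : δ * (δ * M) ≤ δ * M := by nlinarith
  have hδμ : δ * μ ≤ δ * M := by gcongr
  have hδε : δ * ε ≤ δ * M := by gcongr
  obtain ⟨hb1, hb2⟩ := abs_le.1 hb
  rcases lt_abs.1 hfar with h | h
  -- Since `μ` is a convex combination of `a` and `ρ`, excess in the sample means deficit outside
  -- it; `b`, being close to `ρ`, cannot follow `a`.
  · have hρμ : ρ ≤ μ := by
      have : (1 - l) * (μ - ρ) = l * (a - μ) := by rw [hμ]; ring
      have h2 : 0 ≤ (1 - l) * (μ - ρ) := by
        rw [this]; exact mul_nonneg hl0.le (by linarith)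
      linarith [nonneg_of_mul_nonneg_right h2 hl1']
    have hmax : max ρ ε ≤ M := max_le_max hρμ le_rfl
    have h1 : δ / 4 * max ρ ε ≤ δ / 4 * M := by gcongr
    have hbμ : b ≤ μ + δ * M / 4 := by linarith
    rw [mul_max_of_nonneg _ _ (by positivity), max_lt_iff]
    have hab : a - b ≤ |a - b| := le_abs_self _
    constructor
    · refine lt_of_lt_of_le ?_ hab
      have e1 : (μ + δ * M) * (1 - δ / 16) < a * (1 - δ / 16) :=
        mul_lt_mul_of_pos_right (by linarith) (by linarith)
      have e2 : b * (1 + δ / 16) ≤ (μ + δ * M / 4) * (1 + δ / 16) :=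
        mul_le_mul_of_nonneg_right hbμ (by linarith)
      nlinarith
    · linarith
  · have hρμ : μ ≤ ρ := by
      have : (1 - l) * (ρ - μ) = l * (μ - a) := by rw [hμ]; ring
      have h2 : 0 ≤ (1 - l) * (ρ - μ) := by
        rw [this]; exact mul_nonneg hl0.le (by linarith)
      linarith [nonneg_of_mul_nonneg_right h2 hl1']
    have hbμ : μ - δ * M / 4 ≤ b := by
      rcases le_total ρ ε with hρε | hρε
      · rw [max_eq_right hρε] at hb1
        linarith
      · rw [max_eq_left hρε] at hb1
        have : μ * (1 - δ / 4) ≤ ρ * (1 - δ / 4) :=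
          mul_le_mul_of_nonneg_right hρμ (by linarith)
        linarith
    rw [mul_max_of_nonneg _ _ (by positivity), max_lt_iff]
    have hab : b - a ≤ |a - b| := by rw [abs_sub_comm]; exact le_abs_self _
    constructor
    · refine lt_of_lt_of_le ?_ hab
      have e1 : a * (1 + δ / 16) < (μ - δ * M) * (1 + δ / 16) :=
        mul_lt_mul_of_pos_right (by linarith) (by linarith)
      have e2 : (μ - δ * M / 4) * (1 - δ / 16) ≤ b * (1 - δ / 16) :=
        mul_le_mul_of_nonneg_right hbμ (by linarith)
      nlinarith
    · linarith

/-- Relative approximations compose. -/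
theorem relative_close_trans {a a₁ μ ε δ : ℝ} (hε : 0 < ε)
    (hδ : 0 < δ) (hδ1 : δ ≤ 1) (h1 : |a₁ - a| ≤ δ / 4 * max a ε)
    (h2 : |a₁ - μ| ≤ δ / 4 * max μ ε) : |a - μ| ≤ δ * max μ ε := by
  set M := max μ ε with hM
  have hμM : μ ≤ M := le_max_left _ _
  have hεM : ε ≤ M := le_max_right _ _
  have hM0 : 0 < M := by linarith
  have hδM : 0 < δ * M := by positivity
  have hδM1 : δ * (δ * M) ≤ δ * M := by nlinarith
  have hδμ : δ * μ ≤ δ * M := by gcongr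
  have hδε : δ * ε ≤ δ * M := by gcongr
  obtain ⟨h11, h12⟩ := abs_le.1 h1
  obtain ⟨h21, h22⟩ := abs_le.1 h2
  rw [abs_le]
  constructor
  · by_contra! h
    have : max a ε ≤ M := max_le (by linarith) hεM
    have : δ / 4 * max a ε ≤ δ / 4 * M := by gcongr
    linarith
  · by_contra! h
    rcases le_total a ε with ha | ha
    · rw [max_eq_right ha] at h11
      linarith
    · rw [max_eq_left ha] at h11
      have : (μ + δ * M) * (1 - δ / 4) < a * (1 - δ / 4) :=
        mul_lt_mul_of_pos_right (by linarith) (by linarith)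
      nlinarith

variable {α : Type*} [DecidableEq α]

/-- Some range is badly represented by the sample `S`. -/
def Misrepresents (X : Finset α) (F : Finset (Finset α)) (ε δ : ℝ) (S : Finset α) : Prop :=
  ∃ R ∈ F, δ * max ((R.card : ℝ) / X.card) ε <
    |((S ∩ R).card : ℝ) / S.card - (R.card : ℝ) / X.card|

/-- This is `halves_gap` for the frequencies of `R` in `S`, `S'`, `X` and `X \ S`, with weight `l =
m / |X|`, multiplied through by `m`. -/
theorem halvesDisagree_of_far {X S S' R : Finset α} {F : Finset (Finset α)} {m : ℕ} {ε δ : ℝ}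
    (hRF : R ∈ F) (hSX : S ⊆ X) (hS : S.card = m) (hm : 0 < m)
    (hmX : 2 * m ≤ X.card) (hε : 0 < ε) (hδ : 0 < δ) (hδ1 : δ ≤ 1)
    (hfar : δ * max ((R.card : ℝ) / X.card) ε < |((S ∩ R).card : ℝ) / m - (R.card : ℝ) / X.card|)
    (hS' : S' ⊆ X \ S)
    (hclose : |((S' ∩ (R \ S)).card : ℝ) / m - ((R \ S).card : ℝ) / (X \ S).card| ≤
      δ / 4 * max (((R \ S).card : ℝ) / (X \ S).card) ε) :
    HalvesDisagree F ε (δ / 16) S S' := by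
  have hm0 : (0 : ℝ) < m := by exact_mod_cast hm
  have hX0 : (0 : ℝ) < X.card := by exact_mod_cast (by omega : 0 < X.card)
  have hdiff : ((X \ S).card : ℝ) = X.card - m := by
    rw [card_sdiff_of_subset hSX, hS, Nat.cast_sub (by omega)]
  have hd0 : (0 : ℝ) < X.card - m := by
    have : (2 * m : ℝ) ≤ X.card := by exact_mod_cast hmX
    linarith
  have hRS : ((R \ S).card : ℝ) = R.card - (S ∩ R).card := by
    have := card_sdiff_add_card_inter R S
    rw [inter_comm] at this
    rw [eq_sub_iff_add_eq]
    exact_mod_cast this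
  have hinter : S' ∩ (R \ S) = S' ∩ R := by
    ext x
    simp only [mem_inter, mem_sdiff]
    constructor
    · rintro ⟨h1, h2, -⟩; exact ⟨h1, h2⟩
    · rintro ⟨h1, h2⟩; exact ⟨h1, h2, (mem_sdiff.1 (hS' h1)).2⟩
  rw [hinter] at hclose
  have hρ0 : 0 ≤ ((R \ S).card : ℝ) / (X \ S).card := by positivity
  have hgap := halves_gap (a := ((S ∩ R).card : ℝ) / m) (l := m / X.card) (by positivity)
    hρ0 (by positivity) (by rw [div_lt_one hX0]; linarith) (by
      rw [hRS, hdiff]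
      have := hd0.ne'
      field_simp
      ring) hε hδ hδ1 hclose hfar
  refine ⟨R, hRF, ?_⟩
  rw [hS]
  rw [← add_div, ← sub_div, abs_div, abs_of_pos hm0, lt_div_iff₀ hm0] at hgap
  refine lt_of_eq_of_lt ?_ hgap
  rw [mul_assoc, max_mul_of_nonneg _ _ hm0.le, div_mul_cancel₀ _ hm0.ne']

open Classical in
/-- The sampling theorem for samples of at most half of the ground set. -/
theorem PolyTraces.card_misrepresents_le_of_two_mul_le [Fintype α] {F : Finset (Finset α)}
    (hF : PolyTraces F) {X : Finset α} (hFX : ∀ R ∈ F, R ⊆ X) {ε δ Λ : ℝ} (hε : 0 < ε)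
    (hε1 : ε ≤ 1) (hδ : 0 < δ) (hδ1 : δ ≤ 1) (hΛ : 1 ≤ Λ) (hεΛ : ε⁻¹ ≤ Real.exp Λ) {m : ℕ}
    (hmX : 2 * m ≤ X.card) (h : 90177536 * Λ ≤ m * (ε * δ ^ 2)) :
    (((X.powersetCard m).filter (Misrepresents X F ε δ)).card : ℝ) ≤
      8 * Real.exp (-Λ) * (X.powersetCard m).card := by
  have hm : 0 < m := by
    rcases Nat.eq_zero_or_pos m with rfl | hm
    · norm_num at h; linarith
    · exact hm
  have hsym := hF.sum_halvesDisagree_le (δ := δ / 16) hε hε1 (by positivity) hΛ hεΛ (m := m)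
    (by
      have : (m : ℝ) * (ε * (δ / 16) ^ 2) = m * (ε * δ ^ 2) / 256 := by ring
      rw [this]; linarith) X
  have hcardY : ∀ S ∈ X.powersetCard m,
      (((X \ S).powersetCard m).card : ℝ) = ((X.card - m).choose m : ℕ) := by
    intro S hS
    rw [mem_powersetCard] at hS
    rw [card_powersetCard, card_sdiff_of_subset hS.1, hS.2]
  set D : ℝ := (((X.card - m).choose m : ℕ) : ℝ) with hD
  have hD0 : 0 < D := by
    rw [hD]
    exact_mod_cast Nat.choose_pos (by omega)
  have hright : ∑ S ∈ X.powersetCard m, ∑ _S' ∈ (X \ S).powersetCard m, 4 * Real.exp (-Λ) =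
      (X.powersetCard m).card * (D * (4 * Real.exp (-Λ))) := by
    rw [← nsmul_eq_mul, ← sum_const]
    exact sum_congr rfl fun S hS => by rw [sum_const, nsmul_eq_mul, hcardY S hS]
  -- Each bad `S` has at least `D / 2` disjoint partners that represent the offending range well on
  -- `X \ S`, and each of them disagrees with `S`. Replacing `δ` by `δ / 16` costs the factor `256`
  -- in `90177536 = 256 * 352256`.
  have hleft : (((X.powersetCard m).filter (Misrepresents X F ε δ)).card : ℝ) * (D / 2) ≤
      ∑ S ∈ X.powersetCard m, ∑ S' ∈ (X \ S).powersetCard m,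
        (if HalvesDisagree F ε (δ / 16) S S' then (1 : ℝ) else 0) := by
    rw [← nsmul_eq_mul]
    refine (card_nsmul_le_sum _ _ _ fun S hS => ?_).trans
      (sum_le_sum_of_subset_of_nonneg (filter_subset _ _) fun _ _ _ =>
        sum_nonneg fun _ _ => by split_ifs <;> norm_num)
    obtain ⟨hSX, R, hRF, hfar⟩ := mem_filter.1 hS
    rw [mem_powersetCard] at hSX
    rw [hSX.2] at hfar
    have hhalf := card_far_le_half (X \ S) (R \ S) (sdiff_subset_sdiff (hFX R hRF) le_rfl)
      (m := m) (by rw [card_sdiff_of_subset hSX.1, hSX.2]; omega) hε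
      (by positivity : 0 < δ / 4) (by
        have : (m : ℝ) * (ε * (δ / 4) ^ 2) = m * (ε * δ ^ 2) / 16 := by ring
        rw [this]; linarith)
    rw [hcardY S (mem_filter.1 hS).1] at hhalf
    have hsplit := card_filter_add_card_filter_not (s := (X \ S).powersetCard m)
      (fun S' => δ / 4 * max (((R \ S).card : ℝ) / (X \ S).card) ε <
      |((S' ∩ (R \ S)).card : ℝ) / m - (R \ S).card / (X \ S).card|)
    have hsplit' := congrArg (Nat.cast (R := ℝ)) hsplit
    rw [Nat.cast_add, hcardY S (mem_filter.1 hS).1] at hsplit'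
    rw [← sum_filter, sum_const, nsmul_eq_mul, mul_one]
    have hsub : ((X \ S).powersetCard m).filter (fun S' =>
        ¬ δ / 4 * max (((R \ S).card : ℝ) / (X \ S).card) ε <
        |((S' ∩ (R \ S)).card : ℝ) / m - (R \ S).card / (X \ S).card|) ⊆
        ((X \ S).powersetCard m).filter (fun S' => HalvesDisagree F ε (δ / 16) S S') := by
      intro S' hS'
      rw [mem_filter] at hS' ⊢
      exact ⟨hS'.1, halvesDisagree_of_far hRF hSX.1 hSX.2 hm hmX hε hδ hδ1 hfar
        (mem_powersetCard.1 hS'.1).1 (not_lt.1 hS'.2)⟩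
    have hle : ((((X \ S).powersetCard m).filter (fun S' =>
        ¬ δ / 4 * max (((R \ S).card : ℝ) / (X \ S).card) ε <
        |((S' ∩ (R \ S)).card : ℝ) / m - (R \ S).card / (X \ S).card|)).card : ℝ) ≤
        (((X \ S).powersetCard m).filter (fun S' => HalvesDisagree F ε (δ / 16) S S')).card :=
      Nat.cast_le.2 (card_le_card hsub)
    linarith
  have h3 := (hleft.trans hsym).trans_eq hright
  refine le_of_mul_le_mul_right ?_ (half_pos hD0)
  linarith

open Classical in
/-- The sampling theorem for samples of more than half of the ground set, by reduction to smaller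
samples. -/
theorem PolyTraces.card_misrepresents_le_of_lt [Fintype α] {F : Finset (Finset α)}
    (hF : PolyTraces F) {X : Finset α} (hFX : ∀ R ∈ F, R ⊆ X) {ε δ Λ : ℝ} (hε : 0 < ε)
    (hε1 : ε ≤ 1) (hδ : 0 < δ) (hδ1 : δ ≤ 1) (hΛ : 1 ≤ Λ) (hεΛ : ε⁻¹ ≤ Real.exp Λ) {m : ℕ}
    (hmX : m < X.card) (hXm : X.card < 2 * m) (h : 2885681152 * Λ ≤ m * (ε * δ ^ 2)) :
    (((X.powersetCard m).filter (Misrepresents X F ε δ)).card : ℝ) ≤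
      16 * Real.exp (-Λ) * (X.powersetCard m).card := by
  -- No disjoint second sample fits in `X`, so subsamples of size `k` are used. The factor `32` over
  -- the previous constant is `16` for `δ / 4` and `2` for `m ≤ 2 * k`.
  set k := X.card / 2 with hk
  have hkX : 2 * k ≤ X.card := by omega
  have hmk : m ≤ 2 * k := by omega
  have hkm : k ≤ m := by omega
  have hk0 : 0 < k := by omega
  have hk' : 2885681152 * Λ / 2 ≤ k * (ε * δ ^ 2) := by
    have h1 : (m : ℝ) ≤ 2 * k := by exact_mod_cast hmk
    have h2 : (m : ℝ) * (ε * δ ^ 2) ≤ 2 * k * (ε * δ ^ 2) := by gcongr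
    linarith
  have hk'' : (k : ℝ) * (ε * (δ / 4) ^ 2) = k * (ε * δ ^ 2) / 16 := by ring
  have hsmall := hF.card_misrepresents_le_of_two_mul_le hFX (δ := δ / 4) hε hε1 (by positivity)
    (by linarith) hΛ hεΛ hkX (by rw [hk'']; linarith)
  -- Double counting of pairs `S₁ ⊆ S`: if `S` is bad for `R`, at least half of its `k`-subsets
  -- represent `S ∩ R` well within `S`, hence are bad for `R` at level `δ / 4` by
  -- `relative_close_trans`.
  have hcount : (((X.powersetCard m).filter (Misrepresents X F ε δ)).card : ℝ) *
      ((m.choose k : ℕ) / 2 : ℝ) ≤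
      ((X.powersetCard k).filter (Misrepresents X F ε (δ / 4))).card *
        ((X.card - k).choose (m - k) : ℕ) := by
    have hdc : ∑ S ∈ X.powersetCard m,
        (((S.powersetCard k).filter (Misrepresents X F ε (δ / 4))).card : ℝ) =
        ∑ S₁ ∈ (X.powersetCard k).filter (Misrepresents X F ε (δ / 4)),
          (((X.powersetCard m).filter (fun S => S₁ ⊆ S)).card : ℝ) := by
      simp only [card_eq_sum_ones, Nat.cast_sum]
      refine sum_comm' fun S S₁ => ?_
      simp only [mem_filter, mem_powersetCard]
      constructor
      · rintro ⟨⟨h1, h2⟩, ⟨h3, h4⟩, h5⟩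
        exact ⟨⟨⟨h1, h2⟩, h3⟩, ⟨h3.trans h1, h4⟩, h5⟩
      · rintro ⟨⟨⟨h1, h2⟩, h3⟩, ⟨h6, h4⟩, h5⟩
        exact ⟨⟨h1, h2⟩, ⟨h3, h4⟩, h5⟩
    have hright : ∑ S₁ ∈ (X.powersetCard k).filter (Misrepresents X F ε (δ / 4)),
          (((X.powersetCard m).filter (fun S => S₁ ⊆ S)).card : ℝ) =
        ((X.powersetCard k).filter (Misrepresents X F ε (δ / 4))).card *
        ((X.card - k).choose (m - k) : ℕ) := by
      rw [← nsmul_eq_mul, ← sum_const]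
      refine sum_congr rfl fun S₁ hS₁ => ?_
      have h1 := mem_powersetCard.1 (mem_filter.1 hS₁).1
      rw [card_filter_powersetCard_subset S₁ X m h1.1 (by omega), h1.2]
    rw [← hright, ← hdc, ← nsmul_eq_mul]
    refine (card_nsmul_le_sum _ _ _ fun S hS => ?_).trans
      (sum_le_sum_of_subset_of_nonneg (filter_subset _ _) fun _ _ _ => by positivity)
    obtain ⟨hSX, R, hRF, hfar⟩ := mem_filter.1 hS
    rw [mem_powersetCard] at hSX
    have hhalf := card_far_le_half S (S ∩ R) inter_subset_left
      (m := k) (by omega) hε (by positivity : 0 < δ / 4) (by rw [hk'']; linarith)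
    have hsplit := card_filter_add_card_filter_not (s := S.powersetCard k)
      (fun S₁ => δ / 4 * max (((S ∩ R).card : ℝ) / S.card) ε <
      |((S₁ ∩ (S ∩ R)).card : ℝ) / k - (S ∩ R).card / S.card|)
    have hsplit' := congrArg (Nat.cast (R := ℝ)) hsplit
    rw [Nat.cast_add] at hsplit'
    have hcS : ((S.powersetCard k).card : ℝ) = (m.choose k : ℕ) := by
      rw [card_powersetCard, hSX.2]
    rw [hcS] at hhalf hsplit'
    have hsub : (S.powersetCard k).filter (fun S₁ =>
        ¬ δ / 4 * max (((S ∩ R).card : ℝ) / S.card) ε <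
        |((S₁ ∩ (S ∩ R)).card : ℝ) / k - (S ∩ R).card / S.card|) ⊆
        (S.powersetCard k).filter (Misrepresents X F ε (δ / 4)) := by
      intro S₁ hS₁
      rw [mem_filter] at hS₁ ⊢
      obtain ⟨h1, h2⟩ := hS₁
      refine ⟨h1, R, hRF, ?_⟩
      rw [mem_powersetCard] at h1
      by_contra! h3
      rw [not_lt, ← inter_assoc, inter_eq_left.2 h1.1] at h2
      rw [h1.2] at h3
      exact absurd (relative_close_trans hε hδ hδ1 h2 h3) (not_le.2 hfar)
    have hle : (((S.powersetCard k).filter (fun S₁ =>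
        ¬ δ / 4 * max (((S ∩ R).card : ℝ) / S.card) ε <
        |((S₁ ∩ (S ∩ R)).card : ℝ) / k - (S ∩ R).card / S.card|)).card : ℝ) ≤
        ((S.powersetCard k).filter (Misrepresents X F ε (δ / 4))).card :=
      Nat.cast_le.2 (card_le_card hsub)
    linarith
  have hmul : ((X.card.choose m : ℕ) : ℝ) * (m.choose k : ℕ) =
      (X.card.choose k : ℕ) * ((X.card - k).choose (m - k) : ℕ) := by
    exact_mod_cast Nat.choose_mul (n := X.card) hkm
  have hpos : (0 : ℝ) < (m.choose k : ℕ) := by exact_mod_cast Nat.choose_pos hkm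
  rw [card_powersetCard] at hsmall ⊢
  refine le_of_mul_le_mul_right ?_ (half_pos hpos)
  refine hcount.trans ?_
  calc _ ≤ 8 * Real.exp (-Λ) * (X.card.choose k : ℕ) * ((X.card - k).choose (m - k) : ℕ) := by
        gcongr
    _ = 8 * Real.exp (-Λ) * ((X.card.choose m : ℕ) * (m.choose k : ℕ)) := by rw [hmul]; ring
    _ = _ := by ring

open Classical in
theorem PolyTraces.card_misrepresents_le [Fintype α] {F : Finset (Finset α)}
    (hF : PolyTraces F) {X : Finset α} (hFX : ∀ R ∈ F, R ⊆ X) {ε δ Λ : ℝ} (hε : 0 < ε)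
    (hε1 : ε ≤ 1) (hδ : 0 < δ) (hδ1 : δ ≤ 1) (hΛ : 1 ≤ Λ) (hεΛ : ε⁻¹ ≤ Real.exp Λ) {m : ℕ}
    (hmX : m ≤ X.card)
    (h : 2885681152 * Λ ≤ m * (ε * δ ^ 2) ∨ X.card ≤ m) :
    (((X.powersetCard m).filter (Misrepresents X F ε δ)).card : ℝ) ≤
      16 * Real.exp (-Λ) * (X.powersetCard m).card := by
  rcases hmX.lt_or_eq with hlt | rfl
  · have h' := h.resolve_right (by omega)
    rcases le_or_gt (2 * m) X.card with h2 | h2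
    · refine (hF.card_misrepresents_le_of_two_mul_le hFX hε hε1 hδ hδ1 hΛ hεΛ h2
        (by linarith)).trans ?_
      gcongr
      norm_num
    · exact hF.card_misrepresents_le_of_lt hFX hε hε1 hδ hδ1 hΛ hεΛ hlt h2 h'
  · rw [powersetCard_self]
    have : ({X} : Finset (Finset α)).filter (Misrepresents X F ε δ) = ∅ := by
      refine filter_eq_empty_iff.2 fun S hS => ?_
      rw [mem_singleton.1 hS]
      rintro ⟨R, hR, hlt⟩
      rw [inter_eq_right.2 (hFX R hR), sub_self, abs_zero] at hlt
      have : 0 < max ((R.card : ℝ) / X.card) ε := lt_max_of_lt_right hε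
      have := mul_pos hδ this
      linarith
    rw [this]
    simp
    positivity

open Classical in
/-- The failure probability of a random sample is at most `γ`. -/
theorem PolyTraces.card_not_isRelativeApprox_le [Fintype α] {F : Finset (Finset α)}
    (hF : PolyTraces F) {X : Finset α} (hFX : ∀ R ∈ F, R ⊆ X) {l ε δ γ : ℝ} (hl : 0 < l)
    (hε : 0 < ε) (hε1 : ε ≤ 1) (hδ : 0 < δ) (hδ1 : δ ≤ 1) (hγ : 0 < γ) (hγ1 : γ ≤ 1)
    (hL : l ≤ Real.log ε⁻¹ + Real.log γ⁻¹) {m : ℕ} (hm : 0 < m) (hmX : m ≤ X.card)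
    (h : 2885681152 * (1 + (1 + Real.log 16) / l) *
      ((Real.log ε⁻¹ + Real.log γ⁻¹) / (ε * δ ^ 2)) ≤ m ∨ X.card ≤ m) :
    (((X.powersetCard m).filter (fun S => ¬ IsRelativeApprox X F ε δ S)).card : ℝ) ≤
      γ * (X.powersetCard m).card := by
  obtain ⟨L, hLdef⟩ : ∃ L, L = Real.log ε⁻¹ + Real.log γ⁻¹ := ⟨_, rfl⟩
  rw [← hLdef] at hL h
  have hlogε : 0 ≤ Real.log ε⁻¹ := Real.log_nonneg ((one_le_inv₀ hε).2 hε1)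
  have hlogγ : 0 ≤ Real.log γ⁻¹ := Real.log_nonneg ((one_le_inv₀ hγ).2 hγ1)
  have hlog16 : 0 ≤ Real.log 16 := Real.log_nonneg (by norm_num)
  -- Because `l ≤ L`, this multiple of `L` is at least `L + 1 + log 16`: the `1` secures `1 ≤ Λ` and
  -- `log 16` cancels the prefactor `16`.
  set Λ := (1 + (1 + Real.log 16) / l) * L with hΛdef
  have hΛL : L + 1 + Real.log 16 ≤ Λ := by
    have h1 : (1 + Real.log 16) / l * l ≤ (1 + Real.log 16) / l * L := by gcongr
    rw [div_mul_cancel₀ _ hl.ne'] at h1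
    rw [hΛdef]
    linarith
  have hεΛ : ε⁻¹ ≤ Real.exp Λ := by
    rw [← Real.log_le_iff_le_exp (by positivity)]
    linarith
  have h16 : 16 * Real.exp (-Λ) ≤ γ := by
    have e1 : Real.exp (-Λ) ≤ Real.exp (Real.log γ - Real.log 16) := by
      rw [Real.exp_le_exp]
      rw [Real.log_inv γ] at hLdef
      linarith
    rw [Real.exp_sub, Real.exp_log hγ, Real.exp_log (by norm_num)] at e1
    linarith
  have hmain := hF.card_misrepresents_le hFX hε hε1 hδ hδ1 (Λ := Λ) (by linarith) hεΛ hmX (by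
    refine h.imp_left fun h => ?_
    rw [← mul_div_assoc, div_le_iff₀ (by positivity)] at h
    rw [hΛdef]
    linarith)
  have hsub : (X.powersetCard m).filter (fun S => ¬ IsRelativeApprox X F ε δ S) ⊆
      (X.powersetCard m).filter (Misrepresents X F ε δ) := by
    intro S hS
    rw [mem_filter] at hS ⊢
    refine ⟨hS.1, ?_⟩
    by_contra hns
    refine hS.2 ⟨(mem_powersetCard.1 hS.1).1, ?_, fun R hR => ?_⟩
    · rw [← card_pos, (mem_powersetCard.1 hS.1).2]
      exact hm
    · by_contra! hlt
      exact hns ⟨R, hR, hlt⟩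
  calc _ ≤ (((X.powersetCard m).filter (Misrepresents X F ε δ)).card : ℝ) :=
        Nat.cast_le.2 (card_le_card hsub)
    _ ≤ _ := hmain
    _ ≤ _ := by gcongr

end RelativeApproximation

/-! ### Union bound and conclusion -/

theorem one_sub_le_uniformSampleProb {α ι : Type*} [DecidableEq α] (X : Finset α) {m : ℕ}
    (hm : m ≤ X.card) (I : Finset ι) (A : ι → Finset α → Prop) {γ : ℝ}
    (h : ∀ i ∈ I, (open Classical in
      (((X.powersetCard m).filter (fun S => ¬ A i S)).card : ℝ) ≤ γ * (X.powersetCard m).card)) :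
    1 - I.card * γ ≤ uniformSampleProb X m (fun S => ∀ i ∈ I, A i S) := by
  classical
  have hpos : (0 : ℝ) < (X.powersetCard m).card := by
    rw [card_powersetCard]
    exact_mod_cast Nat.choose_pos hm
  rw [uniformSampleProb, le_div_iff₀ hpos]
  have hsplit := card_filter_add_card_filter_not (s := X.powersetCard m)
    (fun S => ∀ i ∈ I, A i S)
  have hsplit' := congrArg (Nat.cast (R := ℝ)) hsplit
  rw [Nat.cast_add] at hsplit'
  have hsub : (X.powersetCard m).filter (fun S => ¬ ∀ i ∈ I, A i S) ⊆
      I.biUnion (fun i => (X.powersetCard m).filter (fun S => ¬ A i S)) := by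
    intro S hS
    obtain ⟨h1, h2⟩ := mem_filter.1 hS
    push Not at h2
    obtain ⟨i, hi, hA⟩ := h2
    exact mem_biUnion.2 ⟨i, hi, mem_filter.2 ⟨h1, hA⟩⟩
  have hle : (((X.powersetCard m).filter (fun S => ¬ ∀ i ∈ I, A i S)).card : ℝ) ≤
      I.card * (γ * (X.powersetCard m).card) := by
    calc _ ≤ ∑ i ∈ I, (((X.powersetCard m).filter (fun S => ¬ A i S)).card : ℝ) := by
          exact_mod_cast (card_le_card hsub).trans card_biUnion_le
      _ ≤ I.card • (γ * (X.powersetCard m).card) :=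
          sum_le_card_nsmul _ _ _ fun i hi => by convert h i hi
      _ = _ := nsmul_eq_mul _ _
  have hge : (1 - I.card * γ) * ((X.powersetCard m).card : ℝ) ≤
      ((X.powersetCard m).filter (fun S => ∀ i ∈ I, A i S)).card := by linarith
  refine hge.trans_eq ?_
  congr!

theorem mainTheorem2 (η : ℝ) (hη : η < 1) :
    ∃ C : ℝ, 0 < C ∧
      ∀ (V : Type*) [Fintype V] [DecidableEq V] (G : SimpleGraph V) [DecidableRel G.Adj]
        (Γ : StraightLineDrawing V) (v : V) (ε δ γ : ℝ),
        0 < ε → ε ≤ 1 → 0 < δ → δ ≤ 1 → 0 < γ → γ ≤ 1 →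
        (G.degree v : ℝ) * γ ≤ 1 →
        ε * γ ≤ η →
        ∀ m : ℕ, m ≤ G.edgeFinset.card →
          min (C * ((Real.log ε⁻¹ + Real.log γ⁻¹) / (ε * δ ^ 2))) (G.edgeFinset.card : ℝ) ≤ m →
          1 - (G.degree v : ℝ) * γ ≤
            uniformSampleProb G.edgeFinset m
              (fun S => ∀ u ∈ G.neighborFinset v,
                IsRelativeApprox G.edgeFinset (coFamily G Γ u v) ε δ S) := by
  rcases le_or_gt η 0 with hη0 | hη0
  · refine ⟨1, one_pos, ?_⟩
    intro V _ _ G _ Γ v ε δ γ hε _ _ _ hγ _ _ hεγ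
    exact absurd (mul_pos hε hγ) (by linarith)
  have hl : 0 < Real.log η⁻¹ := Real.log_pos ((one_lt_inv₀ hη0).2 hη)
  have hlog16 : 0 ≤ Real.log 16 := Real.log_nonneg (by norm_num)
  have hC : 0 < 2885681152 * (1 + (1 + Real.log 16) / Real.log η⁻¹) := by positivity
  refine ⟨_, hC, ?_⟩
  intro V _ _ G _ Γ v ε δ γ hε hε1 hδ hδ1 hγ hγ1 _ hεγ m hmE hmin
  have hL : Real.log η⁻¹ ≤ Real.log ε⁻¹ + Real.log γ⁻¹ := by
    rw [← Real.log_mul (by positivity) (by positivity), ← mul_inv]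
    exact Real.log_le_log (by positivity) (by gcongr)
  have hm : 2885681152 * (1 + (1 + Real.log 16) / Real.log η⁻¹) *
      ((Real.log ε⁻¹ + Real.log γ⁻¹) / (ε * δ ^ 2)) ≤ m ∨ G.edgeFinset.card ≤ m :=
    (min_le_iff.1 hmin).imp_right fun h => by exact_mod_cast h
  rw [← G.card_neighborFinset_eq_degree v]
  refine one_sub_le_uniformSampleProb G.edgeFinset hmE (G.neighborFinset v) _ fun u hu => ?_
  have hadj : G.Adj v u := (G.mem_neighborFinset v u).1 hu
  obtain ⟨F, hF, hFE, hFeq⟩ := exists_polyTraces_coFamily G Γ hadj.ne'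
  -- An empty sample is never an approximation. If the minimum is `|E|`, the edge `vu` itself makes
  -- `m` positive.
  have hm0 : 0 < m := by
    rcases hm with h | h
    · have hLpos : 0 < Real.log ε⁻¹ + Real.log γ⁻¹ := hl.trans_le hL
      have : (0 : ℝ) < m := lt_of_lt_of_le (by positivity) h
      exact_mod_cast this
    · refine lt_of_lt_of_le (card_pos.2 ⟨s(v, u), ?_⟩) h
      exact G.mem_edgeFinset.2 hadj
  rw [hFeq]
  exact hF.card_not_isRelativeApprox_le hFE hl hε hε1 hδ hδ1 hγ hγ1 hL hm0 hmE hm
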